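/- Let $G$ be a Lie group with Lie algebra $L(G)$, let $\pi:P\to M$ be a smooth principal $G$-bundle, and let $\overline{A}$ be a connection form on it, with curvature $F^{\overline A}=d\overline A+\frac12[\overline A,\overline A]$, where $[\eta,\zeta](X,Y)=[\eta(X),\zeta(Y)]-[\eta(Y),\zeta(X)]$. A map $c:[t_0,t_1]\to X$ is said to backtrack over $[T,T+\delta]$, where $t_0\le T<T+2\delta<t_1$, if $c(T+u)=c(T+2\delta-u)$ for all $u\in[0,\delta]$; erasing this backtrack produces the map $c_0$ on $[t_0,t_1-2\delta]$ given by $c_0(t)=c(t)$ for $t\in[t_0,T]$ and $c_0(t)=c(t+2\delta)$ for $t\in[T,t_1-2\delta]$. A continuous vector field $\tilde v$ along an $\overline A$-horizontal piecewise $C^1$ path $\tilde\gamma$ in $P$ satisfies the tangency condition if $$\frac{\partial \overline A(\tilde v(t))}{\partial t}=F^{\overline A}\bigl(\tilde\gamma'(t),\tilde v(t)\bigr)$$ at every point $t$ of the domain of $\tilde\gamma$ at which $\tilde\gamma'(t)$ exists (derivatives at the end points of the domain being one-sided). Let $\tilde\gamma:[t_0,t_1]\to P$ be an $\overline A$-horizontal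 piecewise $C^1$ path and let $\tilde v:[t_0,t_1]\to TP$ be a continuous vector field along $\tilde\gamma$ that satisfies the tangency condition. Suppose that the path $\gamma=\pi\circ\tilde\gamma$ backtracks over $[T,T+\delta]$ and that the vector field $v=\pi_*\tilde v$ along $\gamma$, as a map $[t_0,t_1]\to TM$, also backtracks over $[T,T+\delta]$. Then: (i) the path $\tilde\gamma$ backtracks over $[T,T+\delta]$; (ii) the vector field $\tilde v$, as a map $[t_0,t_1]\to TP$, backtracks over $[T,T+\delta]$; (iii) the path $\tilde\gamma_0$ obtained by erasing the backtrack over $[T,T+\delta]$ from $\tilde\gamma$ is an $\overline A$-horizontal piecewise $C^1$ path, and erasing the backtrack over $[T,T+\delta]$ from $\tilde v$ produces a continuous vector field along $\tilde\gamma_0$ that satisfies the tangency condition. -/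

import Mathlib

open Set
open scoped Manifold ContDiff Topology

noncomputable section

/-! ### Paths, backtracking and erasure of backtracks -/

section Paths

/-- The map `c : [t₀, t₁] → X` backtracks over `[T, T + δ]`; only the values of `c` on `[t₀, t₁]`
matter. -/
def BacktracksOver {X : Type*} (c : ℝ → X) (t₀ t₁ T δ : ℝ) : Prop :=
  t₀ ≤ T ∧ T < T + 2 * δ ∧ T + 2 * δ < t₁ ∧
    ∀ u ∈ Icc 0 δ, c (T + u) = c (T + 2 * δ - u)

/-- Erasure of the backtrack over `[T, T + δ]` from `c : [t₀, t₁] → X`, to be regarded as a map on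
`[t₀, t₁ - 2δ]`. -/
def eraseBacktrack {X : Type*} (c : ℝ → X) (T δ : ℝ) : ℝ → X :=
  fun t => if t ≤ T then c t else c (t + 2 * δ)

variable {E : Type*} [NormedAddCommGroup E] [NormedSpace ℝ E]
  {X : Type*} [TopologicalSpace X] [ChartedSpace E X]

/-- `c : [a, b] → X` is piecewise `C¹`: it is continuous, and there are finitely many break points
such that `c` is `C¹` (one-sidedly at the ends) on each closed subinterval with no break point in
its interior. -/
def IsPiecewiseC1 (c : ℝ → X) (a b : ℝ) : Prop :=
  ContinuousOn c (Icc a b) ∧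
    ∃ s : Finset ℝ, ∀ x y : ℝ, x < y → Icc x y ⊆ Icc a b → Disjoint (Ioo x y) (s : Set ℝ) →
      ContMDiffOn 𝓘(ℝ, ℝ) 𝓘(ℝ, E) 1 c (Icc x y)

/-- The path `c : [a, b] → X` has a derivative at `t` (one-sided at `a` and `b`). -/
def HasVelocityAt (c : ℝ → X) (a b t : ℝ) : Prop :=
  MDifferentiableWithinAt 𝓘(ℝ, ℝ) 𝓘(ℝ, E) c (Icc a b) t

/-- The velocity `c'(t) ∈ T_{c(t)} X` of the path `c : [a, b] → X` (one-sided at `a` and `b`). -/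
def velocity (c : ℝ → X) (a b t : ℝ) : TangentSpace 𝓘(ℝ, E) (c t) :=
  mfderivWithin 𝓘(ℝ, ℝ) 𝓘(ℝ, E) c (Icc a b) t (1 : ℝ)

/-- `v : [a, b] → TX` is a continuous vector field along `c : [a, b] → X`. -/
def IsContinuousFieldAlong [IsManifold 𝓘(ℝ, E) 1 X] (c : ℝ → X)
    (v : ℝ → TangentBundle 𝓘(ℝ, E) X) (a b : ℝ) : Prop :=
  ContinuousOn v (Icc a b) ∧ ∀ t ∈ Icc a b, (v t).proj = c t

end Paths

/-! ### Exterior derivative of a vector-valued `1`-form on a manifold -/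

section Forms

variable {E : Type*} [NormedAddCommGroup E] [NormedSpace ℝ E]
  {X : Type*} [TopologicalSpace X] [ChartedSpace E X]
  {F : Type*} [NormedAddCommGroup F] [NormedSpace ℝ F]

/-- The expression in the chart at `p` of an `F`-valued `1`-form `η` on `X`, that is, the pullback
of `η` under the inverse of the chart. -/
def chartForm (η : ∀ q : X, TangentSpace 𝓘(ℝ, E) q →L[ℝ] F) (p : X) (y : E) : E →L[ℝ] F :=
  (η ((extChartAt 𝓘(ℝ, E) p).symm y)).comp
    (mfderiv 𝓘(ℝ, E) 𝓘(ℝ, E) (extChartAt 𝓘(ℝ, E) p).symm y)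

/-- The exterior derivative `dη` at `p` of an `F`-valued `1`-form `η`, computed in the chart at `p`;
the normalisation is `dη(X, Y) = X (η Y) - Y (η X) - η [X, Y]`. -/
def extDerivOneForm (η : ∀ q : X, TangentSpace 𝓘(ℝ, E) q →L[ℝ] F) (p : X)
    (v w : TangentSpace 𝓘(ℝ, E) p) : F :=
  extDeriv (fun y => ContinuousAlternatingMap.ofSubsingleton ℝ E F (0 : Fin 1) (chartForm η p y))
    (extChartAt 𝓘(ℝ, E) p p)
    ![mfderiv 𝓘(ℝ, E) 𝓘(ℝ, E) (extChartAt 𝓘(ℝ, E) p) p v,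
      mfderiv 𝓘(ℝ, E) 𝓘(ℝ, E) (extChartAt 𝓘(ℝ, E) p) p w]

end Forms

/-! ### Principal bundles and connections -/

/-- The adjoint map `Ad(g) : L(G) → L(G)`, the derivative of `x ↦ g x g⁻¹` at the identity. -/
def lieAd {EG : Type*} [NormedAddCommGroup EG] [NormedSpace ℝ EG]
    {G : Type*} [TopologicalSpace G] [ChartedSpace EG G] [Group G] (g : G)
    (Y : GroupLieAlgebra 𝓘(ℝ, EG) G) : GroupLieAlgebra 𝓘(ℝ, EG) G :=
  mfderiv 𝓘(ℝ, EG) 𝓘(ℝ, EG) (fun x : G => g * x * g⁻¹) 1 Y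

section Bundles

variable (EG : Type*) [NormedAddCommGroup EG] [NormedSpace ℝ EG]
  (EP : Type*) [NormedAddCommGroup EP] [NormedSpace ℝ EP]
  (EM : Type*) [NormedAddCommGroup EM] [NormedSpace ℝ EM]
  (G : Type*) [TopologicalSpace G] [ChartedSpace EG G] [Group G]
  (P : Type*) [TopologicalSpace P] [ChartedSpace EP P]
  (M : Type*) [TopologicalSpace M] [ChartedSpace EM M]

/-- A smooth principal `G`-bundle `π : P → M`: a smooth surjection with a smooth free right action
of `G` on `P` preserving the fibres, locally trivial in a `G`-equivariant way. -/
structure PrincipalBundle where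
  /-- The bundle projection `π`. -/
  proj : P → M
  /-- The right action `(p, g) ↦ p g`. -/
  act : P → G → P
  contMDiff_proj : ContMDiff 𝓘(ℝ, EP) 𝓘(ℝ, EM) ∞ proj
  surjective_proj : Function.Surjective proj
  contMDiff_act :
    ContMDiff (𝓘(ℝ, EP).prod 𝓘(ℝ, EG)) 𝓘(ℝ, EP) ∞ (fun x : P × G => act x.1 x.2)
  act_one : ∀ p, act p 1 = p
  act_mul : ∀ p g h, act p (g * h) = act (act p g) h
  act_free : ∀ p g, act p g = p → g = 1
  proj_act : ∀ p g, proj (act p g) = proj p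
  locally_trivial : ∀ x : M, ∃ U : Set M, IsOpen U ∧ x ∈ U ∧
    ∃ φ : PartialDiffeomorph (𝓘(ℝ, EM).prod 𝓘(ℝ, EG)) 𝓘(ℝ, EP) (M × G) P ∞,
      φ.source = U ×ˢ univ ∧ φ.target = proj ⁻¹' U ∧
      ∀ u ∈ U, ∀ g h : G, proj (φ (u, g)) = u ∧ act (φ (u, g)) h = φ (u, g * h)

variable {EG EP EM G P M}

/-- A connection form on a principal bundle: a smooth `L(G)`-valued `1`-form `ω` on `P` with
`ω (X g) = Ad(g⁻¹) (ω X)`, and `ω (Ỹ(p)) = Y` for `Y ∈ L(G)`, where `Ỹ(p)`, the image of `Y` under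
the derivative at `1` of `g ↦ p g`, is the initial velocity of `t ↦ p exp(tY)`. -/
structure ConnectionForm [IsManifold 𝓘(ℝ, EP) 1 P] (B : PrincipalBundle EG EP EM G P M) where
  /-- The underlying `1`-form. -/
  form : ∀ p : P, TangentSpace 𝓘(ℝ, EP) p →L[ℝ] GroupLieAlgebra 𝓘(ℝ, EG) G
  contMDiff_form : ContMDiff 𝓘(ℝ, EP).tangent 𝓘(ℝ, EG) ∞ (M' := EG)
    (fun w : TangentBundle 𝓘(ℝ, EP) P => form w.proj w.snd)
  form_act : ∀ (p : P) (g : G) (X : TangentSpace 𝓘(ℝ, EP) p),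
    form (B.act p g) (mfderiv 𝓘(ℝ, EP) 𝓘(ℝ, EP) (fun q => B.act q g) p X) =
      lieAd g⁻¹ (form p X)
  form_fundamental : ∀ (p : P) (Y : GroupLieAlgebra 𝓘(ℝ, EG) G),
    form (B.act p 1) (mfderiv 𝓘(ℝ, EG) 𝓘(ℝ, EP) (B.act p) 1 Y) = Y

namespace ConnectionForm

variable [IsManifold 𝓘(ℝ, EP) 1 P] {B : PrincipalBundle EG EP EM G P M}

/-- The `2`-form `[η, ζ](X, Y) = [η X, ζ Y] - [η Y, ζ X]`, for `η = ζ = A`. -/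
def bracketForm (A : ConnectionForm B) (p : P) (v w : TangentSpace 𝓘(ℝ, EP) p) :
    GroupLieAlgebra 𝓘(ℝ, EG) G :=
  ⁅A.form p v, A.form p w⁆ - ⁅A.form p w, A.form p v⁆

/-- The exterior derivative `dA`; here `L(G)`, the tangent space of `G` at `1`, is by definition the
vector space `EG`. -/
def extDerivForm (A : ConnectionForm B) (p : P) (v w : TangentSpace 𝓘(ℝ, EP) p) :
    GroupLieAlgebra 𝓘(ℝ, EG) G :=
  extDerivOneForm (F := EG) A.form p v w

/-- The curvature `2`-form `dA + ½ [A, A]`. -/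
def curvature (A : ConnectionForm B) (p : P) (v w : TangentSpace 𝓘(ℝ, EP) p) :
    GroupLieAlgebra 𝓘(ℝ, EG) G :=
  A.extDerivForm p v w + (1 / 2 : ℝ) • A.bracketForm p v w

/-- The path `c : [a, b] → P` is horizontal: `A(c'(t)) = 0` wherever `c'(t)` exists. -/
def IsHorizontal (A : ConnectionForm B) (c : ℝ → P) (a b : ℝ) : Prop :=
  ∀ t ∈ Icc a b, HasVelocityAt (E := EP) c a b t → A.form (c t) (velocity c a b t) = 0

/-- The tangency condition for a vector field `v` along `c : [a, b] → P`:
`∂A(v(t))/∂t = F(c'(t), v(t))` at every point `t` of `[a, b]` at which `c'(t)` exists. Here `w` is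
`v t`, regarded as an element of `T_{c(t)} P`. -/
def TangencyCondition (A : ConnectionForm B) (c : ℝ → P) (v : ℝ → TangentBundle 𝓘(ℝ, EP) P)
    (a b : ℝ) : Prop :=
  ∀ t ∈ Icc a b, HasVelocityAt (E := EP) c a b t →
    ∀ w : TangentSpace 𝓘(ℝ, EP) (c t), v t = ⟨c t, w⟩ →
      HasDerivWithinAt (fun s => A.form (v s).proj (v s).snd)
        (A.curvature (c t) (velocity c a b t) w) (Icc a b) t

end ConnectionForm

end Bundles

end

/-!
Off a finite set of times, `c` is differentiable and horizontal and `A(v)` has derivative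
`F(c', v) = dA(c', v)`; the bracket term of the curvature drops out because `A(c') = 0`. Both
conditions are invariant under reparametrisation of time, including its reversal. They also
determine `(c, v)` from its projection and its initial value: two horizontal lifts of the same path
differ by a translation in `G` whose derivative vanishes, and, since `dA(u, w) = 0` for `u`
horizontal and `w` vertical, the derivative of `A(v)` depends only on the projection of `v`. The two
halves `u ↦ T + δ ± u` of the backtrack start at the same vector of `TP`, so they agree.

After the erasure both conditions hold off a finite set of times again. As `c` is `C¹` up to the
ends of the pieces, one-sided limits recover them at the exceptional times at which the velocity
exists.
-/

/-! ### Calculus -/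

section Calculus

variable {E : Type*} [NormedAddCommGroup E] [NormedSpace ℝ E]
  {F : Type*} [NormedAddCommGroup F] [NormedSpace ℝ F]
  {V : Type*} [NormedAddCommGroup V] [NormedSpace ℝ V]

theorem eq_of_hasDerivAt_zero_off_countable {g : ℝ → E} {a b : ℝ} {s : Set ℝ} (hs : s.Countable)
    (hg : ContinuousOn g (uIcc a b))
    (hg' : ∀ t ∈ Ioo (min a b) (max a b) \ s, HasDerivAt g 0 t) : g b = g a := by
  -- The fundamental theorem of calculus is available in complete spaces only.
  let i : E →L[ℝ] UniformSpace.Completion E := UniformSpace.Completion.toComplL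
  have hi := MeasureTheory.integral_eq_of_hasDerivAt_off_countable (i ∘ g) (fun _ => 0) hs
    (i.continuous.comp_continuousOn hg)
    (fun t ht => by simpa using i.hasFDerivAt.comp_hasDerivAt t (hg' t ht))
    intervalIntegrable_const
  rw [intervalIntegral.integral_zero, eq_comm, sub_eq_zero] at hi
  exact UniformSpace.Completion.coe_injective E hi

theorem hasDerivWithinAt_Icc_of_continuousOn {g D : ℝ → E} {a b t : ℝ} (hab : a < b)
    (hg : ContinuousOn g (Icc a b)) (hD : ContinuousOn D (Icc a b))
    (hgD : ∀ u ∈ Ioo a b, HasDerivAt g (D u) u) (ht : t ∈ Icc a b) :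
    HasDerivWithinAt g (D t) (Icc a b) t := by
  rw [← closure_Ioo hab.ne] at hg ht ⊢
  refine hasFDerivWithinAt_closure_of_tendsto_fderiv
    (fun u hu => (hgD u hu).differentiableAt.differentiableWithinAt) (convex_Ioo a b) isOpen_Ioo
    (fun u hu => (hg u hu).mono subset_closure) ?_
  have hDt : Filter.Tendsto (fun u => ContinuousLinearMap.toSpanSingleton ℝ (D u)) (𝓝[Ioo a b] t)
      (𝓝 (ContinuousLinearMap.toSpanSingleton ℝ (D t))) :=
    (ContinuousLinearMap.toSpanSingletonCLE (𝕜 := ℝ) (E := E)).continuous.tendsto _ |>.comp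
      ((hD t (by rwa [← closure_Ioo hab.ne])).mono_left (nhdsWithin_mono t Ioo_subset_Icc_self))
  refine hDt.congr' ?_
  filter_upwards [self_mem_nhdsWithin] with u hu using (hgD u hu).hasFDerivAt.fderiv.symm

theorem fderiv_clm_apply_eq_zero_of_eventually_eq {L : E → V →L[ℝ] F} {x a : E} {b : V} {y : F}
    (hL : DifferentiableAt ℝ L x) (h : ∀ᶠ t : ℝ in 𝓝 0, L (x + t • a) b = y) :
    fderiv ℝ L x a b = 0 := by
  have hLb := hL.clm_apply (differentiableAt_const b)
  have hline : fderiv ℝ (fun z => L z b) x a = 0 := by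
    rw [← hLb.lineDeriv_eq_fderiv, lineDeriv, Filter.EventuallyEq.deriv_eq h, deriv_const]
  simpa [fderiv_clm_apply hL (differentiableAt_const b)] using hline

theorem contDiffOn_clm_of_uncurry {L : E → V →L[ℝ] F} {s : Set E} {n : ℕ∞ω} (hs : IsOpen s)
    (hL : ContDiffOn ℝ (n + 1) (fun z : E × V => L z.1 z.2) (s ×ˢ univ)) : ContDiffOn ℝ n L s := by
  have hopen : IsOpen (s ×ˢ (univ : Set V)) := hs.prod isOpen_univ
  have hfderiv : ContDiffOn ℝ n
      (fun x => (fderiv ℝ (fun z : E × V => L z.1 z.2) (x, 0)).comp (.inr ℝ E V)) s :=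
    ((hL.fderiv_of_isOpen hopen le_rfl).comp (contDiff_prodMk_left 0).contDiffOn
      fun x hx => ⟨hx, mem_univ _⟩).clm_comp contDiffOn_const
  refine hfderiv.congr fun x hx => ?_
  have hd : DifferentiableAt ℝ (fun z : E × V => L z.1 z.2) (x, 0) :=
    (hL.differentiableOn (by simp)).differentiableAt (hopen.mem_nhds ⟨hx, mem_univ _⟩)
  exact (L x).hasFDerivAt.unique (hd.hasFDerivAt.comp (0 : V) (hasFDerivAt_prodMk_right x 0))

theorem map_vecCons_vecCons_sub (f : E [⋀^Fin 2]→L[ℝ] F) (a x y : E) :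
    f ![a, x - y] = f ![a, x] - f ![a, y] := by
  have hupdate (z : E) : ![a, z] = Function.update ![a, 0] 1 z := by
    ext i
    fin_cases i <;> rfl
  rw [hupdate (x - y), f.map_update_sub, ← hupdate, ← hupdate]

theorem extDeriv_ofSubsingleton_apply {η : E → E →L[ℝ] F} {x : E} (h : DifferentiableAt ℝ η x)
    (v w : E) :
    extDeriv (fun y => ContinuousAlternatingMap.ofSubsingleton ℝ E F (0 : Fin 1) (η y)) x ![v, w] =
      fderiv ℝ η x v w - fderiv ℝ η x w v := by
  have hη : DifferentiableAt ℝ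
      (fun y => ContinuousAlternatingMap.ofSubsingleton ℝ E F (0 : Fin 1) (η y)) x :=
    (ContinuousAlternatingMap.ofSubsingletonLIE (𝕜 := ℝ) (E := E) (F := F)
      (0 : Fin 1)).toContinuousLinearEquiv.differentiableAt.comp x h
  have hflip : ∀ u : E, fderiv ℝ (fun y => η y u) x = (fderiv ℝ η x).flip u := fun u => by
    ext z
    rw [fderiv_clm_apply h (differentiableAt_const u)]
    simp
  rw [extDeriv_apply hη]
  simp [Fin.sum_univ_two, Fin.removeNth, hflip, sub_eq_add_neg]

end Calculus

theorem exists_Icc_mem_nhdsWithin_disjoint {a b t : ℝ} {s : Set ℝ} (hs : s.Finite) (hab : a < b)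
    (ht : t ∈ Icc a b) :
    ∃ x y, x < y ∧ t ∈ Icc x y ∧ Icc x y ⊆ Icc a b ∧ Icc x y ∈ 𝓝[Icc a b] t ∧
      Disjoint (Ioo x t) s ∧ Disjoint (Ioo t y) s := by
  have hnhds : (s \ {t})ᶜ ∈ 𝓝 t := hs.sdiff.isClosed.isOpen_compl.mem_nhds fun h => h.2 rfl
  obtain ⟨ε, hε, hball⟩ := Metric.nhds_basis_closedBall.mem_iff.1 hnhds
  rw [Real.closedBall_eq_Icc] at hball
  have hnhds_Icc : Icc (t - ε) (t + ε) ∈ 𝓝 t := Icc_mem_nhds (by linarith) (by linarith)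
  have hx : max a (t - ε) ≤ t := max_le ht.1 (by linarith)
  have hy : t ≤ min b (t + ε) := le_min ht.2 (by linarith)
  refine ⟨max a (t - ε), min b (t + ε), ?_, ⟨hx, hy⟩,
    Icc_subset_Icc (le_max_left _ _) (min_le_left _ _), ?_, ?_, ?_⟩
  · exact max_lt (lt_min hab (by linarith [ht.1])) (lt_min (by linarith [ht.2]) (by linarith))
  · rw [← Icc_inter_Icc]
    exact inter_mem_nhdsWithin _ hnhds_Icc
  · refine disjoint_left.2 fun z hz hzs => hball ?_ ⟨hzs, hz.2.ne⟩
    exact ⟨(le_max_right _ _).trans hz.1.le, by linarith [hz.2]⟩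
  · refine disjoint_left.2 fun z hz hzs => hball ?_ ⟨hzs, hz.1.ne'⟩
    exact ⟨by linarith [hz.1], hz.2.le.trans (min_le_right _ _)⟩

/-! ### Exterior derivatives of one-forms -/

section OneForms

variable {E : Type*} [NormedAddCommGroup E] [NormedSpace ℝ E]
  {X : Type*} [TopologicalSpace X] [ChartedSpace E X]
  {F : Type*} [NormedAddCommGroup F] [NormedSpace ℝ F]
  {W : Type*} [NormedAddCommGroup W] [NormedSpace ℝ W]

/-- A smooth `F`-valued `1`-form on `X`; smoothness is that of the function it defines on the
tangent bundle, as for connection forms. -/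
def IsSmoothOneForm [IsManifold 𝓘(ℝ, E) 1 X] (η : ∀ q : X, TangentSpace 𝓘(ℝ, E) q →L[ℝ] F) : Prop :=
  ContMDiff 𝓘(ℝ, E).tangent 𝓘(ℝ, F) ∞ (fun w : TangentBundle 𝓘(ℝ, E) X => η w.proj w.snd)

/-- The pullback `f^* η` of a `1`-form `η` on `X` to a normed space. The form `chartForm η p` is the
pullback of `η` under the inverse of the chart at `p`. -/
noncomputable def pullbackForm (η : ∀ q : X, TangentSpace 𝓘(ℝ, E) q →L[ℝ] F) (f : W → X) (y : W) :
    W →L[ℝ] F :=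
  (η (f y)).comp (mfderiv% f y)

theorem pullbackForm_congr (η : ∀ q : X, TangentSpace 𝓘(ℝ, E) q →L[ℝ] F) {f g : W → X} {y : W}
    (h : f =ᶠ[𝓝 y] g) : pullbackForm η f y = pullbackForm η g y := by
  ext a
  exact (congrArg (fun L : W →L[ℝ] E => (η (f y) : E →L[ℝ] F) (L a)) h.mfderiv_eq).trans
    (congrArg (fun q => (η q : E →L[ℝ] F) (mfderiv% g y a)) h.self_of_nhds)

theorem pullbackForm_comp {V : Type*} [NormedAddCommGroup V] [NormedSpace ℝ V]
    (η : ∀ q : X, TangentSpace 𝓘(ℝ, E) q →L[ℝ] F) {f : W → X} {g : V → W} {y : V}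
    (hf : MDiffAt f (g y)) (hg : DifferentiableAt ℝ g y) :
    pullbackForm η (f ∘ g) y = (pullbackForm η f (g y)).comp (fderiv ℝ g y) := by
  rw [pullbackForm, mfderiv_comp y hf hg.mdifferentiableAt, mfderiv_eq_fderiv]
  rfl

theorem mfderiv_slice_left {V : Type*} [NormedAddCommGroup V] [NormedSpace ℝ V] {f : W × V → X}
    {z : W × V} (hf : MDifferentiableAt 𝓘(ℝ, W × V) 𝓘(ℝ, E) f z) (a : W) :
    (mfderiv% (fun x => f (x, z.2)) z.1 a : E) = mfderiv 𝓘(ℝ, W × V) 𝓘(ℝ, E) f z (a, 0) := by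
  have hslice := hasFDerivAt_prodMk_left (𝕜 := ℝ) z.1 z.2
  refine (mfderiv_comp_apply (I' := 𝓘(ℝ, W × V)) z.1 (f := (·, z.2)) hf
    hslice.differentiableAt.mdifferentiableAt a).trans ?_
  rw [mfderiv_eq_fderiv, hslice.fderiv]
  rfl

theorem mfderiv_slice_right {V : Type*} [NormedAddCommGroup V] [NormedSpace ℝ V] {f : W × V → X}
    {z : W × V} (hf : MDifferentiableAt 𝓘(ℝ, W × V) 𝓘(ℝ, E) f z) (b : V) :
    (mfderiv% (fun y => f (z.1, y)) z.2 b : E) = mfderiv 𝓘(ℝ, W × V) 𝓘(ℝ, E) f z (0, b) := by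
  have hslice := hasFDerivAt_prodMk_right (𝕜 := ℝ) z.1 z.2
  refine (mfderiv_comp_apply (I' := 𝓘(ℝ, W × V)) z.2 (f := (z.1, ·)) hf
    hslice.differentiableAt.mdifferentiableAt b).trans ?_
  rw [mfderiv_eq_fderiv, hslice.fderiv]
  rfl

theorem pullbackForm_apply_inl (η : ∀ q : X, TangentSpace 𝓘(ℝ, E) q →L[ℝ] F) {V : Type*}
    [NormedAddCommGroup V] [NormedSpace ℝ V] {f : W × V → X} {z : W × V}
    (hf : MDifferentiableAt 𝓘(ℝ, W × V) 𝓘(ℝ, E) f z) (a : W) :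
    pullbackForm η f z (a, 0) = pullbackForm η (fun x => f (x, z.2)) z.1 a :=
  congrArg (η (f z)) (mfderiv_slice_left hf a).symm

theorem pullbackForm_apply_inr (η : ∀ q : X, TangentSpace 𝓘(ℝ, E) q →L[ℝ] F) {V : Type*}
    [NormedAddCommGroup V] [NormedSpace ℝ V] {f : W × V → X} {z : W × V}
    (hf : MDifferentiableAt 𝓘(ℝ, W × V) 𝓘(ℝ, E) f z) (b : V) :
    pullbackForm η f z (0, b) = pullbackForm η (fun y => f (z.1, y)) z.2 b :=
  congrArg (η (f z)) (mfderiv_slice_right hf b).symm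

theorem extDerivOneForm_smul_left (η : ∀ q : X, TangentSpace 𝓘(ℝ, E) q →L[ℝ] F) {q : X} (r : ℝ)
    (v w : TangentSpace 𝓘(ℝ, E) q) :
    extDerivOneForm η q (r • v) w = r • extDerivOneForm η q v w := by
  rw [extDerivOneForm, map_smul]
  exact (extDeriv _ _).vecCons_smul ![_] r _

theorem extDerivOneForm_sub_right (η : ∀ q : X, TangentSpace 𝓘(ℝ, E) q →L[ℝ] F) {q : X}
    (u v w : TangentSpace 𝓘(ℝ, E) q) :
    extDerivOneForm η q u (v - w) = extDerivOneForm η q u v - extDerivOneForm η q u w := by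
  rw [extDerivOneForm, map_sub]
  exact map_vecCons_vecCons_sub (extDeriv _ _) _ _ _

variable [IsManifold 𝓘(ℝ, E) 1 X]

theorem mfderiv_extChartAt_symm_mfderiv_extChartAt {p q : X}
    (hq : q ∈ (extChartAt 𝓘(ℝ, E) p).source) (u : TangentSpace 𝓘(ℝ, E) q) :
    mfderiv% (extChartAt 𝓘(ℝ, E) p).symm (extChartAt 𝓘(ℝ, E) p q)
      (mfderiv% (extChartAt 𝓘(ℝ, E) p) q u) = u := by
  have h := mfderivWithin_extChartAt_symm_comp_mfderiv_extChartAt' (I := 𝓘(ℝ, E)) hq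
  rw [modelWithCornersSelf_coe, range_id, mfderivWithin_univ] at h
  exact congrArg (fun L => L u) h

theorem fderiv_extChartAt_comp_apply {f : W → X} {p : X} {y : W} (hf : MDiffAt f y)
    (hy : f y ∈ (extChartAt 𝓘(ℝ, E) p).source) (b : W) :
    fderiv ℝ (extChartAt 𝓘(ℝ, E) p ∘ f) y b =
      mfderiv% (extChartAt 𝓘(ℝ, E) p) (f y) (mfderiv% f y b) := by
  rw [extChartAt_source] at hy
  rw [← mfderiv_eq_fderiv]
  exact mfderiv_comp_apply y (mdifferentiableAt_extChartAt hy) hf b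

theorem pullbackForm_eq_chartForm_comp (η : ∀ q : X, TangentSpace 𝓘(ℝ, E) q →L[ℝ] F) {f : W → X}
    {p : X} {y : W} (hf : CMDiffAt 1 f y) (hy : f y ∈ (extChartAt 𝓘(ℝ, E) p).source) :
    pullbackForm η f y = (chartForm η p (extChartAt 𝓘(ℝ, E) p (f y))).comp
      (fderiv ℝ (extChartAt 𝓘(ℝ, E) p ∘ f) y) := by
  have hchart : CMDiffAt 1 (extChartAt 𝓘(ℝ, E) p ∘ f) y :=
    (contMDiffAt_extChartAt' (by rwa [extChartAt_source] at hy)).comp y hf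
  have hsymm : CMDiffAt 1 (extChartAt 𝓘(ℝ, E) p).symm (extChartAt 𝓘(ℝ, E) p (f y)) :=
    (contMDiffOn_extChartAt_symm p).contMDiffAt
      ((isOpen_extChartAt_target p).mem_nhds ((extChartAt 𝓘(ℝ, E) p).map_source hy))
  have hleft : f =ᶠ[𝓝 y] (extChartAt 𝓘(ℝ, E) p).symm ∘ extChartAt 𝓘(ℝ, E) p ∘ f := by
    filter_upwards [hf.continuousAt.eventually ((isOpen_extChartAt_source p).mem_nhds hy)]
      with z hz using ((extChartAt 𝓘(ℝ, E) p).left_inv hz).symm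
  rw [pullbackForm_congr η hleft, pullbackForm_comp (g := extChartAt 𝓘(ℝ, E) p ∘ f) η
    (hsymm.mdifferentiableAt one_ne_zero) (hchart.mdifferentiableAt one_ne_zero).differentiableAt]
  rfl

theorem pullbackForm_eventuallyEq_chartForm_comp (η : ∀ q : X, TangentSpace 𝓘(ℝ, E) q →L[ℝ] F)
    {f : W → X} {x : W} (hf : CMDiffAt 1 f x) :
    pullbackForm η f =ᶠ[𝓝 x] fun y => (chartForm η (f x) ((extChartAt 𝓘(ℝ, E) (f x) ∘ f) y)).comp
      (fderiv ℝ (extChartAt 𝓘(ℝ, E) (f x) ∘ f) y) := by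
  filter_upwards [(contMDiffAt_iff_contMDiffAt_nhds (by simp)).1 hf,
    hf.continuousAt.eventually (extChartAt_source_mem_nhds (I := 𝓘(ℝ, E)) (f x))]
    with y hy hys using pullbackForm_eq_chartForm_comp η hy hys

end OneForms

section ExteriorDerivative

variable {E : Type*} [NormedAddCommGroup E] [NormedSpace ℝ E]
  {X : Type*} [TopologicalSpace X] [ChartedSpace E X] [IsManifold 𝓘(ℝ, E) ∞ X]
  {F : Type*} [NormedAddCommGroup F] [NormedSpace ℝ F]
  {W : Type*} [NormedAddCommGroup W] [NormedSpace ℝ W]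
  {η : ∀ q : X, TangentSpace 𝓘(ℝ, E) q →L[ℝ] F}

theorem contMDiff_mk_tangentBundle_modelSpace {n : ℕ∞ω} :
    ContMDiff 𝓘(ℝ, E × E) 𝓘(ℝ, E).tangent n
      (fun z : E × E => (⟨z.1, z.2⟩ : TangentBundle 𝓘(ℝ, E) E)) := by
  intro z
  refine Bundle.contMDiffAt_totalSpace.2 ⟨contDiff_fst.contMDiff.contMDiffAt, ?_⟩
  refine contDiff_snd.contMDiff.contMDiffAt.congr_of_eventuallyEq (.of_forall fun y => ?_)
  simp

theorem IsSmoothOneForm.contDiffOn_chartForm (hη : IsSmoothOneForm η) (p : X) :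
    ContDiffOn ℝ ∞ (chartForm η p) (extChartAt 𝓘(ℝ, E) p).target := by
  have hopen : IsOpen (extChartAt 𝓘(ℝ, E) p).target := isOpen_extChartAt_target p
  have hsymm : CMDiff[(extChartAt 𝓘(ℝ, E) p).target] ∞ (extChartAt 𝓘(ℝ, E) p).symm :=
    contMDiffOn_extChartAt_symm p
  have htangent : ContMDiffOn 𝓘(ℝ, E × E) 𝓘(ℝ, E).tangent ∞
      (fun z : E × E => tangentMapWithin 𝓘(ℝ, E) 𝓘(ℝ, E) (extChartAt 𝓘(ℝ, E) p).symm
        (extChartAt 𝓘(ℝ, E) p).target ⟨z.1, z.2⟩) ((extChartAt 𝓘(ℝ, E) p).target ×ˢ univ) :=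
    (hsymm.contMDiffOn_tangentMapWithin (m := ∞) (by simp) hopen.uniqueMDiffOn).comp
      contMDiff_mk_tangentBundle_modelSpace.contMDiffOn fun z hz => hz.1
  refine contDiffOn_clm_of_uncurry hopen ?_
  refine (contMDiffOn_iff_contDiffOn.1 (hη.comp_contMDiffOn htangent)).congr fun z hz => ?_
  simp only [Function.comp_apply, tangentMapWithin, mfderivWithin_of_isOpen hopen hz.1]
  rfl

theorem IsSmoothOneForm.differentiableAt_chartForm (hη : IsSmoothOneForm η) {p : X} {y : E}
    (hy : y ∈ (extChartAt 𝓘(ℝ, E) p).target) : DifferentiableAt ℝ (chartForm η p) y :=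
  ((hη.contDiffOn_chartForm p).differentiableOn (by simp)).differentiableAt
    ((isOpen_extChartAt_target p).mem_nhds hy)

theorem IsSmoothOneForm.differentiableAt_pullbackForm (hη : IsSmoothOneForm η) {f : W → X} {x : W}
    (hf : CMDiffAt 2 f x) : DifferentiableAt ℝ (pullbackForm η f) x := by
  have hψf : ContDiffAt ℝ 2 (extChartAt 𝓘(ℝ, E) (f x) ∘ f) x :=
    contMDiffAt_iff_contDiffAt.1 ((contMDiffAt_extChartAt (n := 2)).comp x hf)
  have hform : DifferentiableAt ℝ (chartForm η (f x)) ((extChartAt 𝓘(ℝ, E) (f x) ∘ f) x) :=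
    hη.differentiableAt_chartForm (mem_extChartAt_target (f x))
  exact ((hform.comp x (hψf.differentiableAt two_ne_zero)).clm_comp
    ((hψf.fderiv_right (m := 1) le_rfl).differentiableAt one_ne_zero)).congr_of_eventuallyEq
      (pullbackForm_eventuallyEq_chartForm_comp η (hf.of_le one_le_two))

theorem IsSmoothOneForm.extDerivOneForm_mfderiv (hη : IsSmoothOneForm η) {f : W → X} {x : W}
    (hf : CMDiffAt 2 f x) (a b : W) :
    extDerivOneForm η (f x) (mfderiv% f x a) (mfderiv% f x b) =
      fderiv ℝ (pullbackForm η f) x a b - fderiv ℝ (pullbackForm η f) x b a := by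
  set ψ := extChartAt 𝓘(ℝ, E) (f x)
  have hψf : ContDiffAt ℝ 2 (ψ ∘ f) x :=
    contMDiffAt_iff_contDiffAt.1 ((contMDiffAt_extChartAt (n := 2)).comp x hf)
  have hpull : (fun y => ContinuousAlternatingMap.ofSubsingleton ℝ W F (0 : Fin 1)
      (pullbackForm η f y)) =ᶠ[𝓝 x] fun y => (ContinuousAlternatingMap.ofSubsingleton ℝ E F
        (0 : Fin 1) (chartForm η (f x) ((ψ ∘ f) y))).compContinuousLinearMap (fderiv ℝ (ψ ∘ f) y) :=
    (pullbackForm_eventuallyEq_chartForm_comp η (hf.of_le one_le_two)).fun_comp _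
  have hω : DifferentiableAt ℝ (fun y => ContinuousAlternatingMap.ofSubsingleton ℝ E F (0 : Fin 1)
      (chartForm η (f x) y)) ((ψ ∘ f) x) :=
    (ContinuousAlternatingMap.ofSubsingletonLIE (𝕜 := ℝ) (E := E) (F := F)
      (0 : Fin 1)).toContinuousLinearEquiv.differentiableAt.comp _
      (hη.differentiableAt_chartForm (mem_extChartAt_target (f x)))
  have hψ (c : W) := fderiv_extChartAt_comp_apply (hf.mdifferentiableAt two_ne_zero)
    (mem_extChartAt_source (I := 𝓘(ℝ, E)) (f x)) c
  rw [← extDeriv_ofSubsingleton_apply (hη.differentiableAt_pullbackForm hf), hpull.extDeriv_eq,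
    extDeriv_pullback hω hψf (by simp), ContinuousAlternatingMap.compContinuousLinearMap_apply,
    extDerivOneForm, ← hψ a, ← hψ b]
  congr 1
  ext i
  fin_cases i <;> rfl

theorem IsSmoothOneForm.extDerivOneForm_eq_zero_of_slices {V : Type*} [NormedAddCommGroup V]
    [NormedSpace ℝ V] (hη : IsSmoothOneForm η) {f : W × V → X} {x : W} {y : V}
    (hf : ContMDiffAt 𝓘(ℝ, W × V) 𝓘(ℝ, E) 2 f (x, y)) {a : W} {b : V} {m n : F}
    (hx : ∀ᶠ y' in 𝓝 y, pullbackForm η (fun x' => f (x', y')) x a = m)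
    (hy : ∀ᶠ x' in 𝓝 x, pullbackForm η (fun y' => f (x', y')) y b = n) :
    extDerivOneForm η (f (x, y)) (mfderiv% (fun x' => f (x', y)) x a)
      (mfderiv% (fun y' => f (x, y')) y b) = 0 := by
  have hf_nhds : ∀ᶠ z in 𝓝 (x, y), MDifferentiableAt 𝓘(ℝ, W × V) 𝓘(ℝ, E) f z := by
    filter_upwards [(contMDiffAt_iff_contMDiffAt_nhds (by simp)).1 hf]
      with z hz using hz.mdifferentiableAt two_ne_zero
  have hline (c : W × V) : Filter.Tendsto (fun t : ℝ => (x, y) + t • c) (𝓝 0) (𝓝 (x, y)) :=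
    Continuous.tendsto' (by fun_prop) _ _ (by simp)
  have hpull := hη.differentiableAt_pullbackForm hf
  have hab : fderiv ℝ (pullbackForm η f) (x, y) (a, 0) (0, b) = 0 := by
    refine fderiv_clm_apply_eq_zero_of_eventually_eq (y := n) hpull ?_
    filter_upwards [(hline (a, 0)).eventually hf_nhds,
      ((continuous_fst.tendsto _).comp (hline (a, 0))).eventually hy] with t ht hyt
    rw [← hyt, pullbackForm_apply_inr η ht]
    simp
  have hba : fderiv ℝ (pullbackForm η f) (x, y) (0, b) (a, 0) = 0 := by
    refine fderiv_clm_apply_eq_zero_of_eventually_eq (y := m) hpull ?_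
    filter_upwards [(hline (0, b)).eventually hf_nhds,
      ((continuous_snd.tendsto _).comp (hline (0, b))).eventually hx] with t ht hxt
    rw [← hxt, pullbackForm_apply_inl η ht]
    simp
  have hzero := hη.extDerivOneForm_mfderiv hf (a, 0) (0, b)
  rw [hab, hba, sub_zero] at hzero
  exact (congrArg₂ (fun u v : E => extDerivOneForm η (f (x, y)) u v)
    (mfderiv_slice_left hf_nhds.self_of_nhds a)
    (mfderiv_slice_right hf_nhds.self_of_nhds b)).trans hzero

theorem IsSmoothOneForm.extDerivOneForm_eq_fderiv_chartForm (hη : IsSmoothOneForm η) {p q : X}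
    (hq : q ∈ (extChartAt 𝓘(ℝ, E) p).source) (v w : TangentSpace 𝓘(ℝ, E) q) :
    extDerivOneForm η q v w =
      fderiv ℝ (chartForm η p) (extChartAt 𝓘(ℝ, E) p q)
          (mfderiv% (extChartAt 𝓘(ℝ, E) p) q v) (mfderiv% (extChartAt 𝓘(ℝ, E) p) q w) -
        fderiv ℝ (chartForm η p) (extChartAt 𝓘(ℝ, E) p q)
          (mfderiv% (extChartAt 𝓘(ℝ, E) p) q w) (mfderiv% (extChartAt 𝓘(ℝ, E) p) q v) := by
  have hsymm : CMDiffAt 2 (extChartAt 𝓘(ℝ, E) p).symm (extChartAt 𝓘(ℝ, E) p q) :=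
    (contMDiffOn_extChartAt_symm p).contMDiffAt
      ((isOpen_extChartAt_target p).mem_nhds ((extChartAt 𝓘(ℝ, E) p).map_source hq))
  refine Eq.trans ?_ (hη.extDerivOneForm_mfderiv hsymm _ _)
  rw [mfderiv_extChartAt_symm_mfderiv_extChartAt hq v,
    mfderiv_extChartAt_symm_mfderiv_extChartAt hq w]
  exact congrArg (fun r => extDerivOneForm η r (v : E) (w : E))
    ((extChartAt 𝓘(ℝ, E) p).left_inv hq).symm

theorem continuousWithinAt_mfderiv_extChartAt {Y : Type*} [TopologicalSpace Y] {S : Set Y} {y₀ : Y}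
    {q : Y → X} {V : ∀ y, TangentSpace 𝓘(ℝ, E) (q y)} {p : X}
    (hV : ContinuousWithinAt (fun y => (⟨q y, V y⟩ : TangentBundle 𝓘(ℝ, E) X)) S y₀)
    (hp : q y₀ ∈ (extChartAt 𝓘(ℝ, E) p).source) :
    ContinuousWithinAt (fun y => (mfderiv% (extChartAt 𝓘(ℝ, E) p) (q y) (V y) : E)) S y₀ := by
  have hopen : IsOpen (extChartAt 𝓘(ℝ, E) p).source := isOpen_extChartAt_source p
  have hchart : CMDiff[(extChartAt 𝓘(ℝ, E) p).source] 1 (extChartAt 𝓘(ℝ, E) p) := by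
    rw [extChartAt_source]
    exact contMDiffOn_extChartAt
  have hpre : IsOpen (Bundle.TotalSpace.proj ⁻¹' (extChartAt 𝓘(ℝ, E) p).source :
      Set (TangentBundle 𝓘(ℝ, E) X)) := hopen.preimage (FiberBundle.continuous_proj E _)
  have htangent := ((hchart.continuousOn_tangentMapWithin le_rfl hopen.uniqueMDiffOn).continuousAt
    (hpre.mem_nhds hp)).comp_continuousWithinAt (f := fun y => ⟨q y, V y⟩) hV
  have hsnd (y : Y) (hy : q y ∈ (extChartAt 𝓘(ℝ, E) p).source) :
      (mfderiv% (extChartAt 𝓘(ℝ, E) p) (q y) (V y) : E) = (tangentMapWithin 𝓘(ℝ, E) 𝓘(ℝ, E)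
        (extChartAt 𝓘(ℝ, E) p) (extChartAt 𝓘(ℝ, E) p).source ⟨q y, V y⟩).snd :=
    congrArg (fun L : E →L[ℝ] E => L (V y)) (mfderivWithin_of_isOpen hopen hy).symm
  refine ((contMDiff_snd_tangentBundle_modelSpace E 𝓘(ℝ, E) (n := 0)).continuous.continuousAt
    |>.comp_continuousWithinAt htangent).congr_of_eventuallyEq ?_ (hsnd y₀ hp)
  filter_upwards [hV.eventually (hpre.mem_nhds hp)] with y hy using hsnd y hy

theorem IsSmoothOneForm.continuousWithinAt_extDerivOneForm (hη : IsSmoothOneForm η)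
    {Y : Type*} [TopologicalSpace Y] {S : Set Y} {y₀ : Y} {q : Y → X}
    {V W : ∀ y, TangentSpace 𝓘(ℝ, E) (q y)}
    (hV : ContinuousWithinAt (fun y => (⟨q y, V y⟩ : TangentBundle 𝓘(ℝ, E) X)) S y₀)
    (hW : ContinuousWithinAt (fun y => (⟨q y, W y⟩ : TangentBundle 𝓘(ℝ, E) X)) S y₀) :
    ContinuousWithinAt (fun y => extDerivOneForm η (q y) (V y) (W y)) S y₀ := by
  have hmem : q y₀ ∈ (extChartAt 𝓘(ℝ, E) (q y₀)).source := mem_extChartAt_source _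
  have hq : ContinuousWithinAt q S y₀ :=
    (FiberBundle.continuous_proj E (TangentSpace 𝓘(ℝ, E) (M := X))).continuousAt
      |>.comp_continuousWithinAt hV
  have hv := continuousWithinAt_mfderiv_extChartAt hV hmem
  have hw := continuousWithinAt_mfderiv_extChartAt hW hmem
  have hchart : ContinuousWithinAt (fun y => extChartAt 𝓘(ℝ, E) (q y₀) (q y)) S y₀ :=
    (continuousAt_extChartAt (q y₀)).comp_continuousWithinAt hq
  have hfderiv : ContinuousAt (fderiv ℝ (chartForm η (q y₀))) (extChartAt 𝓘(ℝ, E) (q y₀) (q y₀)) :=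
    ((hη.contDiffOn_chartForm (q y₀)).continuousOn_fderiv_of_isOpen (isOpen_extChartAt_target _)
      (by simp)).continuousAt (extChartAt_target_mem_nhds (q y₀))
  have hL : ContinuousWithinAt (fun y => fderiv ℝ (chartForm η (q y₀))
      (extChartAt 𝓘(ℝ, E) (q y₀) (q y))) S y₀ := hfderiv.tendsto.comp hchart
  have hd := ((hL.clm_apply hv).clm_apply hw).sub ((hL.clm_apply hw).clm_apply hv)
  refine hd.congr_of_eventuallyEq ?_ (hη.extDerivOneForm_eq_fderiv_chartForm hmem _ _)
  filter_upwards [hq.eventually (extChartAt_source_mem_nhds (I := 𝓘(ℝ, E)) (q y₀))]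
    with y hy using hη.extDerivOneForm_eq_fderiv_chartForm hy _ _

end ExteriorDerivative

/-! ### Paths in a manifold -/

theorem exists_contMDiffAt_mfderiv_eq {E : Type*} [NormedAddCommGroup E] [NormedSpace ℝ E]
    {X : Type*} [TopologicalSpace X] [ChartedSpace E X] [IsManifold 𝓘(ℝ, E) ∞ X] (p : X) (v : E) :
    ∃ α : ℝ → X, CMDiffAt ∞ α 0 ∧ α 0 = p ∧ (mfderiv% α 0 1 : E) = v := by
  set ψ := extChartAt 𝓘(ℝ, E) p
  set u : E := mfderiv% ψ p v
  let l : ℝ → E := fun t => ψ p + t • u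
  have hl : ContDiff ℝ ∞ l := contDiff_const.add (contDiff_id.smul contDiff_const)
  have hl_zero : l 0 = ψ p := by simp [l]
  have hl_deriv : HasDerivAt l u 0 := by
    simpa [l] using ((hasDerivAt_id (0 : ℝ)).smul_const u).const_add (ψ p)
  have hsymm : CMDiffAt ∞ ψ.symm (l 0) := by
    rw [hl_zero]
    exact (contMDiffOn_extChartAt_symm p).contMDiffAt (extChartAt_target_mem_nhds p)
  refine ⟨ψ.symm ∘ l, hsymm.comp 0 hl.contMDiff.contMDiffAt, ?_, ?_⟩
  · rw [Function.comp_apply, hl_zero]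
    exact extChartAt_to_inv p
  · have hchain : (mfderiv% (ψ.symm ∘ l) 0 1 : E) = mfderiv% ψ.symm (l 0) u := by
      refine (mfderiv_comp_apply 0 (hsymm.mdifferentiableAt (by simp))
        (hl.contMDiff.mdifferentiableAt (by simp)) _).trans ?_
      rw [mfderiv_eq_fderiv]
      exact congrArg (mfderiv% ψ.symm (l 0)) hl_deriv.deriv
    exact hchain.trans ((congrArg (fun y => (mfderiv% ψ.symm y : E →L[ℝ] E) u) hl_zero).trans
      (mfderiv_extChartAt_symm_mfderiv_extChartAt (mem_extChartAt_source p) v))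

theorem eq_of_mfderiv_eq_zero_off_countable {E : Type*} [NormedAddCommGroup E] [NormedSpace ℝ E]
    {X : Type*} [TopologicalSpace X] [ChartedSpace E X] [IsManifold 𝓘(ℝ, E) 1 X]
    {h : ℝ → X} {a b : ℝ} {s : Set ℝ} (hs : s.Countable) (hh : ContinuousOn h (Icc a b))
    (hdiff : ∀ u ∈ Ioo a b \ s, MDiffAt h u) (hzero : ∀ u ∈ Ioo a b \ s, mfderiv% h u 1 = 0)
    {x y : ℝ} (hx : x ∈ Icc a b) (hy : y ∈ Icc a b) : h x = h y := by
  refine isPreconnected_Icc.induction₂ (fun x y => h x = h y) (fun x hx => ?_)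
    (fun _ _ _ _ _ _ => Eq.trans) (fun _ _ _ _ => Eq.symm) hx hy
  set ψ := extChartAt 𝓘(ℝ, E) (h x)
  obtain ⟨ε, hε, hsource⟩ := Metric.mem_nhdsWithin_iff.1
    ((hh x hx).preimage_mem_nhdsWithin (extChartAt_source_mem_nhds (I := 𝓘(ℝ, E)) (h x)))
  have hx_mem : x ∈ Metric.ball x ε ∩ Icc a b := ⟨Metric.mem_ball_self hε, hx⟩
  refine Metric.mem_nhdsWithin_iff.2 ⟨ε, hε, fun y hy => ?_⟩
  have hxy : uIcc x y ⊆ Metric.ball x ε ∩ Icc a b := by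
    rw [← segment_eq_uIcc]
    exact ((convex_ball x ε).inter (convex_Icc a b)).segment_subset hx_mem hy
  refine (ψ.injOn (hsource hy) (hsource hx_mem) ?_).symm
  refine eq_of_hasDerivAt_zero_off_countable (g := ψ ∘ h) hs (fun u hu => ?_) fun u hu => ?_
  · exact (continuousAt_extChartAt' (hsource (hxy hu))).comp_continuousWithinAt
      ((hh u (hxy hu).2).mono fun z hz => (hxy hz).2)
  · have hu_ab : u ∈ Ioo a b \ s :=
      ⟨⟨(le_min hx.1 hy.2.1).trans_lt hu.1.1, hu.1.2.trans_le (max_le hx.2 hy.2.2)⟩, hu.2⟩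
    have hu_source : h u ∈ ψ.source := hsource (hxy (Ioo_subset_Icc_self hu.1))
    have hψh : DifferentiableAt ℝ (ψ ∘ h) u := mdifferentiableAt_iff_differentiableAt.1
      ((mdifferentiableAt_extChartAt (by rwa [← extChartAt_source 𝓘(ℝ, E)])).comp u
        (hdiff u hu_ab))
    have hderiv : deriv (ψ ∘ h) u = 0 :=
      (fderiv_extChartAt_comp_apply (hdiff u hu_ab) hu_source 1).trans
        ((congrArg (mfderiv% ψ (h u)) (hzero u hu_ab)).trans (map_zero _))
    exact hderiv ▸ hψh.hasDerivAt

section Velocity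

variable {E : Type*} [NormedAddCommGroup E] [NormedSpace ℝ E]
  {X : Type*} [TopologicalSpace X] [ChartedSpace E X] {c : ℝ → X} {a b t : ℝ}

theorem mfderiv_comp_apply_one {φ : ℝ → ℝ} {r u : ℝ} (hc : MDiffAt c (φ u))
    (hφ : HasDerivAt φ r u) :
    (mfderiv% (c ∘ φ) u 1 : E) = r • (mfderiv% c (φ u) 1 : E) := by
  have hφ_one : (mfderiv% φ u 1 : ℝ) = r • 1 := by
    rw [mfderiv_eq_fderiv]
    exact hφ.deriv.trans (mul_one r).symm
  exact (mfderiv_comp_apply u hc hφ.differentiableAt.mdifferentiableAt _).trans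
    ((congrArg (mfderiv% c (φ u)) hφ_one).trans (map_smul _ _ _))

theorem velocity_eq_mfderiv (ht : t ∈ Ioo a b) :
    velocity (E := E) c a b t = mfderiv 𝓘(ℝ, ℝ) 𝓘(ℝ, E) c t (1 : ℝ) := by
  rw [velocity, mfderivWithin_of_mem_nhds (Icc_mem_nhds ht.1 ht.2)]

theorem velocity_eq_of_Icc_subset {x y : ℝ} (hxy : x < y) (hsub : Icc x y ⊆ Icc a b)
    (ht : t ∈ Icc x y) (hc : HasVelocityAt (E := E) c a b t) :
    velocity (E := E) c x y t = velocity c a b t := by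
  have huniq := uniqueMDiffWithinAt_iff_uniqueDiffWithinAt.2 (uniqueDiffOn_Icc hxy t ht)
  rw [velocity, velocity, MDifferentiableWithinAt.mfderivWithin_mono hc huniq hsub]

theorem continuousOn_velocity [IsManifold 𝓘(ℝ, E) 1 X] (hab : a < b)
    (hc : ContMDiffOn 𝓘(ℝ, ℝ) 𝓘(ℝ, E) 1 c (Icc a b)) :
    ContinuousOn (fun t => (⟨c t, velocity c a b t⟩ : TangentBundle 𝓘(ℝ, E) X)) (Icc a b) := by
  have hone : Continuous fun t : ℝ => (⟨t, (1 : ℝ)⟩ : TangentBundle 𝓘(ℝ, ℝ) ℝ) :=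
    (contMDiff_vectorSpace_iff_contDiff (n := 0) (V := fun _ : ℝ => (1 : ℝ))).2
      contDiff_const |>.continuous
  have huniq := uniqueMDiffOn_iff_uniqueDiffOn.2 (uniqueDiffOn_Icc hab)
  exact (hc.continuousOn_tangentMapWithin le_rfl huniq).comp hone.continuousOn fun t ht => ht

theorem IsPiecewiseC1.mdifferentiableAt_off_finite (hc : IsPiecewiseC1 (E := E) c a b) :
    ∃ s : Set ℝ, s.Finite ∧ ∀ t ∈ Ioo a b \ s, MDifferentiableAt 𝓘(ℝ, ℝ) 𝓘(ℝ, E) c t := by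
  obtain ⟨-, s, hs⟩ := hc
  refine ⟨s, s.finite_toSet, fun t ⟨ht, hts⟩ => ?_⟩
  obtain ⟨ε, hε, hball⟩ := Metric.nhds_basis_closedBall.mem_iff.1
    ((isOpen_Ioo.inter s.finite_toSet.isClosed.isOpen_compl).mem_nhds ⟨ht, hts⟩)
  rw [Real.closedBall_eq_Icc] at hball
  have hc := hs (t - ε) (t + ε) (by linarith) (fun z hz => Ioo_subset_Icc_self (hball hz).1)
    (disjoint_left.2 fun z hz => (hball (Ioo_subset_Icc_self hz)).2)
  exact (hc.contMDiffAt (Icc_mem_nhds (by linarith) (by linarith))).mdifferentiableAt one_ne_zero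

end Velocity

section Erasure

variable {X : Type*} {c : ℝ → X} {t₀ t₁ T δ t : ℝ}

theorem backtracksOver_iff_eqOn_reflection : BacktracksOver c t₀ t₁ T δ ↔
    t₀ ≤ T ∧ 0 < δ ∧ T + 2 * δ < t₁ ∧
      EqOn (fun u => c (T + δ + u)) (fun u => c (T + δ - u)) (Icc 0 δ) := by
  have hδ : T < T + 2 * δ ↔ 0 < δ := by constructor <;> intro h <;> linarith
  refine and_congr_right' (and_congr hδ (and_congr_right' ⟨fun h u hu => ?_, fun h u hu => ?_⟩))
  · have huv := h (δ - u) ⟨by linarith [hu.2], by linarith [hu.1]⟩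
    ring_nf at huv ⊢
    exact huv.symm
  · have huv := h (x := δ - u) ⟨by linarith [hu.2], by linarith [hu.1]⟩
    ring_nf at huv ⊢
    exact huv.symm

namespace BacktracksOver

theorem of_comp_eqOn {Y : Type*} {f : X → Y} {c' : ℝ → Y} (h : BacktracksOver c t₀ t₁ T δ)
    (hf : EqOn (f ∘ c) c' (Icc t₀ t₁)) : BacktracksOver c' t₀ t₁ T δ := by
  obtain ⟨hT, hδ, hT', h⟩ := h
  refine ⟨hT, hδ, hT', fun u hu => ?_⟩
  rw [← hf ⟨by linarith [hu.1], by linarith [hu.2]⟩, ← hf ⟨by linarith [hu.2], by linarith [hu.1]⟩]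
  exact congrArg f (h u hu)

theorem eraseBacktrack_of_ge (h : BacktracksOver c t₀ t₁ T δ) (ht : T ≤ t) :
    eraseBacktrack c T δ t = c (t + 2 * δ) := by
  rcases ht.eq_or_lt with rfl | ht
  · rw [eraseBacktrack, if_pos le_rfl]
    simpa only [add_zero, sub_zero] using h.2.2.2 0 ⟨le_rfl, by linarith [h.2.1]⟩
  · exact if_neg ht.not_ge

theorem continuousOn_eraseBacktrack [TopologicalSpace X] (h : BacktracksOver c t₀ t₁ T δ)
    (hc : ContinuousOn c (Icc t₀ t₁)) :
    ContinuousOn (eraseBacktrack c T δ) (Icc t₀ (t₁ - 2 * δ)) := by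
  have ⟨hT, hδ, hT', _⟩ := h
  rw [← Icc_union_Icc_eq_Icc hT (by linarith : T ≤ t₁ - 2 * δ)]
  refine ContinuousOn.union_of_isClosed ?_ ?_ isClosed_Icc isClosed_Icc
  · exact (hc.mono (Icc_subset_Icc_right (by linarith))).congr fun t ht => if_pos ht.2
  · refine ContinuousOn.congr (f := fun t => c (t + 2 * δ)) ?_ fun t ht =>
      h.eraseBacktrack_of_ge ht.1
    exact hc.comp (by fun_prop) fun t ht => ⟨by linarith [ht.1], by linarith [ht.2]⟩

variable {E : Type*} [NormedAddCommGroup E] [NormedSpace ℝ E] [TopologicalSpace X]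
  [ChartedSpace E X]

theorem contMDiffOn_eraseBacktrack_of_ge {x y : ℝ} {n : ℕ∞ω} (h : BacktracksOver c t₀ t₁ T δ)
    (hx : T ≤ x) (hc : CMDiff[Icc (x + 2 * δ) (y + 2 * δ)] n c) :
    CMDiff[Icc x y] n (eraseBacktrack c T δ) := by
  have hshift : CMDiff n fun t : ℝ => t + 2 * δ := (contDiff_id.add contDiff_const).contMDiff
  refine (hc.comp hshift.contMDiffOn fun t ht => ?_).congr fun t ht =>
    h.eraseBacktrack_of_ge (hx.trans ht.1)
  exact ⟨by linarith [ht.1], by linarith [ht.2]⟩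

theorem isPiecewiseC1_eraseBacktrack (h : BacktracksOver c t₀ t₁ T δ)
    (hc : IsPiecewiseC1 (E := E) c t₀ t₁) :
    IsPiecewiseC1 (E := E) (eraseBacktrack c T δ) t₀ (t₁ - 2 * δ) := by
  classical
  obtain ⟨hcont, s, hs⟩ := hc
  have ⟨_, hδ, _, _⟩ := h
  refine ⟨h.continuousOn_eraseBacktrack hcont, insert T (s ∪ s.image (· - 2 * δ)), ?_⟩
  intro x y hxy hsub hdisj
  have hx := (hsub (left_mem_Icc.2 hxy.le)).1
  have hy := (hsub (right_mem_Icc.2 hxy.le)).2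
  simp only [Finset.coe_insert, Finset.coe_union, Finset.coe_image, disjoint_insert_right,
    disjoint_union_right] at hdisj
  obtain ⟨hT, hs_disj, hs_shift⟩ := hdisj
  rcases le_or_gt y T with hyT | hTy
  · exact (hs x y hxy (Icc_subset_Icc hx (by linarith)) hs_disj).congr fun t ht =>
      if_pos (ht.2.trans hyT)
  · have hTx : T ≤ x := not_lt.1 fun hlt => hT ⟨hlt, hTy⟩
    refine h.contMDiffOn_eraseBacktrack_of_ge hTx (hs _ _ (by linarith)
      (Icc_subset_Icc (by linarith) (by linarith)) (disjoint_left.2 fun z hz hzs => ?_))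
    exact disjoint_left.1 hs_shift ⟨by linarith [hz.1], by linarith [hz.2]⟩
      (mem_image_of_mem (· - 2 * δ) hzs)

end BacktracksOver

namespace IsContinuousFieldAlong

variable {E : Type*} [NormedAddCommGroup E] [NormedSpace ℝ E] [TopologicalSpace X]
  [ChartedSpace E X] [IsManifold 𝓘(ℝ, E) 1 X] {v : ℝ → TangentBundle 𝓘(ℝ, E) X}

theorem comp {φ : ℝ → ℝ} {a b : ℝ} (hv : IsContinuousFieldAlong c v t₀ t₁)
    (hφ : ContinuousOn φ (Icc a b)) (hmaps : MapsTo φ (Icc a b) (Icc t₀ t₁)) :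
    IsContinuousFieldAlong (c ∘ φ) (v ∘ φ) a b :=
  ⟨hv.1.comp hφ hmaps, fun t ht => hv.2 (φ t) (hmaps ht)⟩

theorem eraseBacktrack (hv : IsContinuousFieldAlong c v t₀ t₁) (h : BacktracksOver v t₀ t₁ T δ) :
    IsContinuousFieldAlong (eraseBacktrack c T δ) (eraseBacktrack v T δ) t₀ (t₁ - 2 * δ) := by
  refine ⟨h.continuousOn_eraseBacktrack hv.1, fun t ht => ?_⟩
  have hδ := h.2.1
  unfold _root_.eraseBacktrack
  split_ifs with htT
  · exact hv.2 t ⟨ht.1, by linarith [ht.2]⟩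
  · exact hv.2 _ ⟨by linarith [ht.1], by linarith [ht.2]⟩

end IsContinuousFieldAlong

end Erasure

section Connections

variable {EG : Type*} [NormedAddCommGroup EG] [NormedSpace ℝ EG]
  {EP : Type*} [NormedAddCommGroup EP] [NormedSpace ℝ EP]
  {EM : Type*} [NormedAddCommGroup EM] [NormedSpace ℝ EM]
  {G : Type*} [TopologicalSpace G] [ChartedSpace EG G] [Group G]
  {P : Type*} [TopologicalSpace P] [ChartedSpace EP P]
  {M : Type*} [TopologicalSpace M] [ChartedSpace EM M]

/-! ### Vertical vectors -/

theorem mfderiv_mul_left_eq_zero_iff [LieGroup 𝓘(ℝ, EG) ∞ G] {g h : G}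
    {w : TangentSpace 𝓘(ℝ, EG) h} : mfderiv% (fun x : G => g * x) h w = 0 ↔ w = 0 := by
  have hmul (a b : G) : MDiffAt (fun x : G => a * x) b :=
    (contMDiff_mul_left (I := 𝓘(ℝ, EG)) (n := ∞)).mdifferentiableAt (by simp)
  refine ⟨fun hw => ?_, fun hw => by rw [hw, map_zero]⟩
  have hid : (fun x : G => g⁻¹ * x) ∘ (fun x : G => g * x) = id := by ext x; simp
  have hchain := mfderiv_comp_apply h (hmul g⁻¹ (g * h)) (hmul g h) w
  rw [hw, map_zero, hid, mfderiv_id] at hchain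
  exact hchain

namespace PrincipalBundle

variable (B : PrincipalBundle EG EP EM G P M)

theorem contMDiff_act_const_left (p : P) : CMDiff ∞ (B.act p) :=
  B.contMDiff_act.comp (contMDiff_const.prodMk contMDiff_id)

theorem contMDiff_act_const_right (g : G) : CMDiff ∞ (fun q => B.act q g) :=
  B.contMDiff_act.comp (contMDiff_id.prodMk contMDiff_const)

theorem contMDiffAt_act_prodMap {V W : Type*} [NormedAddCommGroup V] [NormedSpace ℝ V]
    [NormedAddCommGroup W] [NormedSpace ℝ W] {a : V → P} {b : W → G} {x : V} {y : W}
    (ha : CMDiffAt ∞ a x) (hb : CMDiffAt ∞ b y) :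
    ContMDiffAt 𝓘(ℝ, V × W) 𝓘(ℝ, EP) ∞ (fun z => B.act (a z.1) (b z.2)) (x, y) := by
  have ha_fst : ContMDiffAt 𝓘(ℝ, V × W) 𝓘(ℝ, EP) ∞ (fun z : V × W => a z.1) (x, y) :=
    ContMDiffAt.comp (g := a) (x, y) ha contDiff_fst.contDiffAt.contMDiffAt
  have hb_snd : ContMDiffAt 𝓘(ℝ, V × W) 𝓘(ℝ, EG) ∞ (fun z : V × W => b z.2) (x, y) :=
    ContMDiffAt.comp (g := b) (x, y) hb contDiff_snd.contDiffAt.contMDiffAt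
  exact B.contMDiff_act.contMDiffAt.comp (x, y) (ha_fst.prodMk hb_snd)

theorem mdifferentiableAt_proj (p : P) : MDiffAt B.proj p :=
  B.contMDiff_proj.mdifferentiableAt (by simp)

theorem mfderiv_act_comp {E : Type*} [NormedAddCommGroup E] [NormedSpace ℝ E]
    {N : Type*} [TopologicalSpace N] [ChartedSpace E N] {a : N → P} {b : N → G} {n : N}
    (ha : MDiffAt a n) (hb : MDiffAt b n) (w : TangentSpace 𝓘(ℝ, E) n) :
    mfderiv% (fun x => B.act (a x) (b x)) n w =
      mfderiv% (fun q => B.act q (b n)) (a n) (mfderiv% a n w) +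
        mfderiv% (B.act (a n)) (b n) (mfderiv% b n w) := by
  have hact : MDifferentiableAt (𝓘(ℝ, EP).prod 𝓘(ℝ, EG)) 𝓘(ℝ, EP)
      (fun x : P × G => B.act x.1 x.2) (a n, b n) :=
    B.contMDiff_act.mdifferentiableAt (by simp)
  refine (mfderiv_comp_apply (I := 𝓘(ℝ, E)) n (f := fun x => (a x, b x))
    (g := fun x : P × G => B.act x.1 x.2) hact (ha.prodMk hb) w).trans ?_
  rw [mfderiv_prod_eq_add_apply hact, ha.mfderiv_prod hb]
  rfl

theorem exists_local_section (x : M) :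
    ∃ (U : Set M) (s : M → P) (γ : P → G), IsOpen U ∧ x ∈ U ∧
      CMDiff[U] ∞ s ∧ CMDiff[B.proj ⁻¹' U] ∞ γ ∧
      ∀ q ∈ B.proj ⁻¹' U, B.act (s (B.proj q)) (γ q) = q := by
  obtain ⟨U, hU, hxU, φ, hsource, htarget, hφ⟩ := B.locally_trivial x
  refine ⟨U, fun u => φ (u, 1), fun q => (φ.symm q).2, hU, hxU, ?_, ?_, fun q hq => ?_⟩
  · refine φ.contMDiffOn.comp (contMDiff_id.prodMk contMDiff_const).contMDiffOn fun u hu => ?_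
    rw [hsource]
    exact ⟨hu, mem_univ _⟩
  · rw [← htarget]
    exact contMDiff_snd.comp_contMDiffOn φ.symm.contMDiffOn
  · rw [← htarget] at hq
    have hright : φ (φ.symm q) = q := φ.right_inv hq
    have hmem : (φ.symm q).1 ∈ U := (hsource ▸ φ.map_target hq : φ.symm q ∈ U ×ˢ univ).1
    have hproj : B.proj q = (φ.symm q).1 :=
      (congrArg B.proj hright).symm.trans (hφ _ hmem (φ.symm q).2 1).1
    rw [hproj, (hφ _ hmem 1 (φ.symm q).2).2, one_mul]
    exact hright

theorem mfderiv_act_right_eq [LieGroup 𝓘(ℝ, EG) ∞ G] (p : P) (g : G)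
    (w : TangentSpace 𝓘(ℝ, EG) g) :
    (mfderiv% (B.act p) g w : EP) =
      mfderiv% (B.act (B.act p g)) 1 (mfderiv% (fun x : G => g⁻¹ * x) g w : EG) := by
  have hcomp : B.act p = B.act (B.act p g) ∘ (fun x : G => g⁻¹ * x) := by
    ext x
    simp [← B.act_mul]
  have hchain := mfderiv_comp_apply g (g := B.act (B.act p g)) (f := fun x : G => g⁻¹ * x)
    ((B.contMDiff_act_const_left _).mdifferentiableAt (by simp))
    ((contMDiff_mul_left (n := ∞)).mdifferentiableAt (by simp)) w
  rw [← hcomp] at hchain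
  exact hchain.trans (congrArg (fun x => (mfderiv% (B.act (B.act p g)) x : EG →L[ℝ] EP)
    (mfderiv% (fun x : G => g⁻¹ * x) g w)) (inv_mul_cancel g))

theorem exists_mfderiv_act_eq_of_mfderiv_proj_eq_zero [LieGroup 𝓘(ℝ, EG) ∞ G] {p : P}
    {w : TangentSpace 𝓘(ℝ, EP) p} (hw : mfderiv% B.proj p w = 0) :
    ∃ Y : EG, (mfderiv% (B.act p) 1 Y : EP) = w := by
  obtain ⟨U, s, γ, hU, hpU, hs, hγ, hsγ⟩ := B.exists_local_section (B.proj p)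
  have hpre : B.proj ⁻¹' U ∈ 𝓝 p :=
    B.contMDiff_proj.continuous.continuousAt.preimage_mem_nhds (hU.mem_nhds hpU)
  have hs' : MDiffAt s (B.proj p) := (hs.contMDiffAt (hU.mem_nhds hpU)).mdifferentiableAt (by simp)
  have hγ' : MDiffAt γ p := (hγ.contMDiffAt hpre).mdifferentiableAt (by simp)
  have hid : (fun q => B.act ((s ∘ B.proj) q) (γ q)) =ᶠ[𝓝 p] id := by
    filter_upwards [hpre] with q hq using hsγ q hq
  have hsw : mfderiv% (s ∘ B.proj) p w = 0 := by
    rw [mfderiv_comp_apply p hs' (B.mdifferentiableAt_proj p), hw, map_zero]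
  have hchain : (mfderiv% (B.act (s (B.proj p))) (γ p) (mfderiv% γ p w) : EP) = w := by
    have hsum := B.mfderiv_act_comp (hs'.comp p (B.mdifferentiableAt_proj p)) hγ' w
    rw [hid.mfderiv_eq, mfderiv_id, hsw, map_zero, zero_add] at hsum
    exact hsum.symm
  refine ⟨mfderiv% (fun x : G => (γ p)⁻¹ * x) (γ p) (mfderiv% γ p w), ?_⟩
  rw [B.mfderiv_act_right_eq, hsγ p hpU] at hchain
  exact hchain

end PrincipalBundle

namespace ConnectionForm

section Algebra

variable [IsManifold 𝓘(ℝ, EP) 1 P] {B : PrincipalBundle EG EP EM G P M} (A : ConnectionForm B)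

theorem form_mfderiv_act_one (p : P) (Y : GroupLieAlgebra 𝓘(ℝ, EG) G) :
    A.form p (mfderiv% (B.act p) 1 Y : EP) = Y :=
  (congrArg (fun q => A.form q (mfderiv% (B.act p) 1 Y : EP)) (B.act_one p)).symm.trans
    (A.form_fundamental p Y)

theorem form_mfderiv_act [LieGroup 𝓘(ℝ, EG) ∞ G] (p : P) (g : G) (w : TangentSpace 𝓘(ℝ, EG) g) :
    (A.form (B.act p g) (mfderiv% (B.act p) g w) : EG) = mfderiv% (fun x : G => g⁻¹ * x) g w :=
  (congrArg (A.form (B.act p g)) (B.mfderiv_act_right_eq p g w)).trans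
    (A.form_mfderiv_act_one (B.act p g) _)

theorem form_act_eq_zero {p : P} {w : TangentSpace 𝓘(ℝ, EP) p} (hw : A.form p w = 0) (g : G) :
    A.form (B.act p g) (mfderiv% (fun q => B.act q g) p w) = 0 := by
  rw [A.form_act, hw]
  exact map_zero (mfderiv% (fun x : G => g⁻¹ * x * g⁻¹⁻¹) 1)

theorem eq_of_form_eq_of_mfderiv_proj_eq [LieGroup 𝓘(ℝ, EG) ∞ G] {p : P}
    {v w : TangentSpace 𝓘(ℝ, EP) p} (hform : A.form p v = A.form p w)
    (hproj : mfderiv% B.proj p v = mfderiv% B.proj p w) : v = w := by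
  obtain ⟨Y, hY⟩ := B.exists_mfderiv_act_eq_of_mfderiv_proj_eq_zero (w := v - w)
    (by rw [map_sub, hproj, sub_self])
  have hform_zero : A.form p (v - w) = 0 := by rw [map_sub, hform, sub_self]
  have hY_zero : Y = 0 :=
    (A.form_mfderiv_act_one p Y).symm.trans ((congrArg (A.form p) hY).trans hform_zero)
  subst hY_zero
  exact sub_eq_zero.1 (hY.symm.trans (map_zero (mfderiv% (B.act p) 1)))

theorem curvature_eq_extDerivOneForm {p : P} {v : TangentSpace 𝓘(ℝ, EP) p} (hv : A.form p v = 0)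
    (w : TangentSpace 𝓘(ℝ, EP) p) :
    A.curvature p v w = extDerivOneForm (F := EG) A.form p v w := by
  have hinv : mulInvariantVectorField (I := 𝓘(ℝ, EG)) (0 : GroupLieAlgebra 𝓘(ℝ, EG) G) = 0 := by
    ext g
    exact map_zero _
  have hbracket : A.bracketForm p v w = 0 := by
    rw [bracketForm, hv, GroupLieAlgebra.bracket_def, GroupLieAlgebra.bracket_def, hinv]
    simp
  rw [curvature, hbracket, smul_zero, add_zero]
  rfl

end Algebra

section Structure

variable [IsManifold 𝓘(ℝ, EP) ∞ P] {B : PrincipalBundle EG EP EM G P M} (A : ConnectionForm B)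

theorem isSmoothOneForm : IsSmoothOneForm (F := EG) A.form :=
  A.contMDiff_form

variable [LieGroup 𝓘(ℝ, EG) ∞ G]

theorem extDerivOneForm_eq_zero_of_mfderiv_proj_eq_zero {p : P} {v w : TangentSpace 𝓘(ℝ, EP) p}
    (hv : A.form p v = 0) (hw : mfderiv% B.proj p w = 0) :
    extDerivOneForm (F := EG) A.form p v w = 0 := by
  obtain ⟨Y, hY⟩ := B.exists_mfderiv_act_eq_of_mfderiv_proj_eq_zero hw
  obtain ⟨α, hα, rfl, hαv⟩ := exists_contMDiffAt_mfderiv_eq (E := EP) p v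
  obtain ⟨β, hβ, hβ_one, hβY⟩ := exists_contMDiffAt_mfderiv_eq (1 : G) Y
  -- With `α'(0) = v` and `β'(0) = Y`, the function `A(∂f/∂s)` of `t` vanishes and the function
  -- `A(∂f/∂t)` of `s` is constant, so `dA(∂f/∂s, ∂f/∂t) = 0` at the origin.
  let f : ℝ × ℝ → P := fun z => B.act (α z.1) (β z.2)
  have hact_left (g : G) : (mfderiv% (fun s => B.act (α s) g) 0 1 : EP) =
      mfderiv% (fun q => B.act q g) (α 0) (mfderiv% α 0 1) :=
    mfderiv_comp_apply 0 ((B.contMDiff_act_const_right g).mdifferentiableAt (by simp))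
      (hα.mdifferentiableAt (by simp)) _
  have hact_right (q : P) : (mfderiv% (fun t => B.act q (β t)) 0 1 : EP) =
      mfderiv% (B.act q) (β 0) (mfderiv% β 0 1) :=
    mfderiv_comp_apply 0 ((B.contMDiff_act_const_left q).mdifferentiableAt (by simp))
      (hβ.mdifferentiableAt (by simp)) _
  have hslice_left (t : ℝ) : pullbackForm (F := EG) A.form (fun s => f (s, t)) 0 1 = 0 :=
    (congrArg (A.form (f (0, t))) (hact_left (β t))).trans
      (A.form_act_eq_zero ((congrArg (A.form (α 0)) hαv).trans hv) (β t))
  have hslice_right (s : ℝ) : pullbackForm (F := EG) A.form (fun t => f (s, t)) 0 1 =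
      mfderiv% (fun x : G => (β 0)⁻¹ * x) (β 0) (mfderiv% β 0 1) :=
    (congrArg (A.form (f (s, 0))) (hact_right (α s))).trans (A.form_mfderiv_act (α s) (β 0) _)
  have hzero := A.isSmoothOneForm.extDerivOneForm_eq_zero_of_slices
    ((B.contMDiffAt_act_prodMap hα hβ).of_le ENat.LEInfty.out)
    (.of_forall hslice_left) (.of_forall hslice_right)
  have hact_one (q : P) : B.act q (β 0) = q := (congrArg (B.act q) hβ_one).trans (B.act_one q)
  have hf_left : (mfderiv% (fun s => f (s, 0)) 0 1 : EP) = v :=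
    (congrArg (fun c : ℝ → P => (mfderiv% c 0 1 : EP)) (funext fun s => hact_one (α s))).trans hαv
  have hf_right : (mfderiv% (fun t => f (0, t)) 0 1 : EP) = w :=
    (hact_right (α 0)).trans ((congrArg₂ (fun g u => (mfderiv% (B.act (α 0)) g : EG →L[ℝ] EP) u)
      hβ_one hβY).trans hY)
  rw [← hf_left, ← hf_right]
  exact (congrArg (fun q : P => extDerivOneForm (F := EG) A.form q
    (mfderiv% (fun s => f (s, 0)) 0 1 : EP) (mfderiv% (fun t => f (0, t)) 0 1 : EP))
    (hact_one (α 0)).symm).trans hzero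

end Structure

end ConnectionForm

/-! ### Uniqueness of horizontal lifts -/

namespace PrincipalBundle

variable (B : PrincipalBundle EG EP EM G P M)

/-- The translation function of a principal bundle: for `p` and `q` in the same fibre, the unique
`g` with `p g = q`. Its value is arbitrary when `p` and `q` lie in different fibres. -/
noncomputable def translation (p q : P) : G :=
  Classical.epsilon fun g => B.act p g = q

theorem translation_eq_of_act_eq {p q : P} {g : G} (h : B.act p g = q) : B.translation p q = g := by
  have hspec : B.act p (B.translation p q) = q :=
    Classical.epsilon_spec (p := fun g => B.act p g = q) ⟨g, h⟩
  have hfix : B.act p (B.translation p q * g⁻¹) = p := by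
    rw [B.act_mul, hspec, ← h, ← B.act_mul, mul_inv_cancel, B.act_one]
  exact mul_inv_eq_one.1 (B.act_free p _ hfix)

theorem exists_translation_eq (x : M) :
    ∃ (U : Set M) (γ : P → G), IsOpen U ∧ x ∈ U ∧ CMDiff[B.proj ⁻¹' U] ∞ γ ∧
      ∀ p q, B.proj p ∈ U → B.proj p = B.proj q →
        B.act p ((γ p)⁻¹ * γ q) = q ∧ B.translation p q = (γ p)⁻¹ * γ q := by
  obtain ⟨U, s, γ, hU, hxU, -, hγ, hsγ⟩ := B.exists_local_section x
  refine ⟨U, γ, hU, hxU, hγ, fun p q hp hpq => ?_⟩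
  have hact : B.act p ((γ p)⁻¹ * γ q) = q := by
    nth_rw 1 [← hsγ p hp]
    rw [← B.act_mul, mul_inv_cancel_left, hpq]
    exact hsγ q (hpq ▸ hp : B.proj q ∈ U)
  exact ⟨hact, B.translation_eq_of_act_eq hact⟩

theorem act_translation {p q : P} (h : B.proj p = B.proj q) :
    B.act p (B.translation p q) = q := by
  obtain ⟨U, γ, -, hpU, -, hγ⟩ := B.exists_translation_eq (B.proj p)
  rw [(hγ p q hpU h).2, (hγ p q hpU h).1]

theorem exists_contMDiffAt_eq_translation [LieGroup 𝓘(ℝ, EG) ∞ G] {p q : P}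
    (h : B.proj p = B.proj q) :
    ∃ τ : P × P → G, ContMDiffAt (𝓘(ℝ, EP).prod 𝓘(ℝ, EP)) 𝓘(ℝ, EG) ∞ τ (p, q) ∧
      ∀ᶠ z in 𝓝 (p, q), B.proj z.1 = B.proj z.2 → B.translation z.1 z.2 = τ z := by
  obtain ⟨U, γ, hU, hpU, hγ, hact⟩ := B.exists_translation_eq (B.proj p)
  have hpre : IsOpen (B.proj ⁻¹' U) := hU.preimage B.contMDiff_proj.continuous
  refine ⟨fun z => (γ z.1)⁻¹ * γ z.2, ?_, ?_⟩
  · exact ((hγ.contMDiffAt (hpre.mem_nhds hpU)).comp (p, q) contMDiffAt_fst).inv.mul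
      ((hγ.contMDiffAt (hpre.mem_nhds (h ▸ hpU : B.proj q ∈ U))).comp (p, q) contMDiffAt_snd)
  · filter_upwards [(hpre.preimage continuous_fst).mem_nhds hpU] with z hz hproj
      using (hact z.1 z.2 hz hproj).2

theorem continuousWithinAt_translation [LieGroup 𝓘(ℝ, EG) ∞ G] {Y : Type*} [TopologicalSpace Y]
    {c₁ c₂ : Y → P} {s : Set Y} {y : Y} (hc₁ : ContinuousWithinAt c₁ s y)
    (hc₂ : ContinuousWithinAt c₂ s y) (hy : y ∈ s)
    (hproj : ∀ z ∈ s, B.proj (c₁ z) = B.proj (c₂ z)) :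
    ContinuousWithinAt (fun z => B.translation (c₁ z) (c₂ z)) s y := by
  obtain ⟨τ, hτ, heq⟩ := B.exists_contMDiffAt_eq_translation (hproj y hy)
  refine (ContinuousAt.comp_continuousWithinAt (f := fun z => (c₁ z, c₂ z)) hτ.continuousAt
    (hc₁.prodMk hc₂)).congr_of_eventuallyEq_of_mem ?_ hy
  filter_upwards [(hc₁.prodMk hc₂).eventually heq, self_mem_nhdsWithin] with z hz hzs
    using hz (hproj z hzs)

theorem mdifferentiableAt_translation [LieGroup 𝓘(ℝ, EG) ∞ G] {E : Type*} [NormedAddCommGroup E]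
    [NormedSpace ℝ E] {N : Type*} [TopologicalSpace N] [ChartedSpace E N] {c₁ c₂ : N → P} {y : N}
    (hc₁ : MDiffAt c₁ y) (hc₂ : MDiffAt c₂ y)
    (hproj : ∀ᶠ z in 𝓝 y, B.proj (c₁ z) = B.proj (c₂ z)) :
    MDiffAt (fun z => B.translation (c₁ z) (c₂ z)) y := by
  obtain ⟨τ, hτ, heq⟩ := B.exists_contMDiffAt_eq_translation hproj.self_of_nhds
  refine ((hτ.mdifferentiableAt (by simp)).comp y (hc₁.prodMk hc₂)).congr_of_eventuallyEq ?_
  filter_upwards [(hc₁.prodMk hc₂).continuousAt.eventually heq, hproj] with z hz hzproj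
    using hz hzproj

end PrincipalBundle

namespace ConnectionForm

section HorizontalLifts

variable [IsManifold 𝓘(ℝ, EP) 1 P] [LieGroup 𝓘(ℝ, EG) ∞ G] {B : PrincipalBundle EG EP EM G P M}
  (A : ConnectionForm B)

theorem mfderiv_translation_eq_zero {c₁ c₂ : ℝ → P} {u : ℝ} (hc₁ : MDiffAt c₁ u)
    (hc₂ : MDiffAt c₂ u) (hproj : ∀ᶠ t in 𝓝 u, B.proj (c₁ t) = B.proj (c₂ t))
    (hA₁ : A.form (c₁ u) (mfderiv% c₁ u 1) = 0) (hA₂ : A.form (c₂ u) (mfderiv% c₂ u 1) = 0) :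
    mfderiv% (fun t => B.translation (c₁ t) (c₂ t)) u 1 = 0 := by
  set g : ℝ → G := fun t => B.translation (c₁ t) (c₂ t)
  have hg : MDiffAt g u := B.mdifferentiableAt_translation hc₁ hc₂ hproj
  have heq : (fun t => B.act (c₁ t) (g t)) =ᶠ[𝓝 u] c₂ := by
    filter_upwards [hproj] with t ht using B.act_translation ht
  have hzero : pullbackForm (F := EG) A.form (fun t => B.act (c₁ t) (g t)) u 1 = 0 :=
    (congrArg (fun L : ℝ →L[ℝ] EG => L 1) (pullbackForm_congr (F := EG) A.form heq)).trans hA₂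
  have hleibniz : A.form (B.act (c₁ u) (g u)) (mfderiv% (fun q => B.act q (g u)) (c₁ u)
      (mfderiv% c₁ u 1)) + A.form (B.act (c₁ u) (g u)) (mfderiv% (B.act (c₁ u)) (g u)
      (mfderiv% g u 1)) = 0 :=
    (map_add _ _ _).symm.trans
      ((congrArg (A.form (B.act (c₁ u) (g u))) (B.mfderiv_act_comp hc₁ hg 1)).symm.trans hzero)
  rw [A.form_act_eq_zero hA₁, zero_add] at hleibniz
  exact mfderiv_mul_left_eq_zero_iff.1 ((A.form_mfderiv_act _ _ _).symm.trans hleibniz)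

theorem eqOn_of_form_mfderiv_eq_zero {c₁ c₂ : ℝ → P} {a b : ℝ} {s : Set ℝ} (hs : s.Countable)
    (hc₁ : ContinuousOn c₁ (Icc a b)) (hc₂ : ContinuousOn c₂ (Icc a b))
    (hdiff₁ : ∀ u ∈ Ioo a b \ s, MDiffAt c₁ u) (hdiff₂ : ∀ u ∈ Ioo a b \ s, MDiffAt c₂ u)
    (hA₁ : ∀ u ∈ Ioo a b \ s, A.form (c₁ u) (mfderiv% c₁ u 1) = 0)
    (hA₂ : ∀ u ∈ Ioo a b \ s, A.form (c₂ u) (mfderiv% c₂ u 1) = 0)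
    (hproj : ∀ u ∈ Icc a b, B.proj (c₁ u) = B.proj (c₂ u)) (ha : c₁ a = c₂ a) :
    EqOn c₁ c₂ (Icc a b) := by
  intro u hu
  have : IsManifold 𝓘(ℝ, EG) 1 G := .of_le (n := ∞) (by simp)
  have hproj_nhds (t : ℝ) (ht : t ∈ Ioo a b) : ∀ᶠ z in 𝓝 t, B.proj (c₁ z) = B.proj (c₂ z) :=
    Filter.eventually_of_mem (Icc_mem_nhds ht.1 ht.2) hproj
  have hconst : B.translation (c₁ u) (c₂ u) = B.translation (c₁ a) (c₂ a) :=
    eq_of_mfderiv_eq_zero_off_countable (h := fun t => B.translation (c₁ t) (c₂ t)) hs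
      (fun t ht => B.continuousWithinAt_translation (hc₁ t ht) (hc₂ t ht) ht hproj)
      (fun t ht => B.mdifferentiableAt_translation (hdiff₁ t ht) (hdiff₂ t ht) (hproj_nhds t ht.1))
      (fun t ht => A.mfderiv_translation_eq_zero (hdiff₁ t ht) (hdiff₂ t ht) (hproj_nhds t ht.1)
        (hA₁ t ht) (hA₂ t ht)) hu (left_mem_Icc.2 (hu.1.trans hu.2))
  rw [B.translation_eq_of_act_eq (p := c₁ a) (g := 1) ((B.act_one _).trans ha)] at hconst
  rw [← B.act_translation (hproj u hu), hconst, B.act_one]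

end HorizontalLifts

/-! ### Vector fields tangent to the space of horizontal paths -/

section IsTangentAt

variable [IsManifold 𝓘(ℝ, EP) 1 P] {B : PrincipalBundle EG EP EM G P M} (A : ConnectionForm B)

/-- The vector field `v` along `c` is tangent at time `t` to the space of horizontal paths: `c` is
differentiable and horizontal at `t`, and `v` satisfies the tangency condition there. On a
horizontal velocity the curvature agrees with `dA`, which is used in its place. -/
structure IsTangentAt (c : ℝ → P) (v : ℝ → TangentBundle 𝓘(ℝ, EP) P) (t : ℝ) : Prop where
  mdifferentiableAt : MDiffAt c t
  form_eq_zero : A.form (c t) (mfderiv% c t 1) = 0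
  hasDerivAt : HasDerivAt (F := EG) (fun s => A.form (v s).proj (v s).snd)
    (extDerivOneForm (F := EG) A.form (c t) (mfderiv% c t 1 : EP) ((v t).snd : EP)) t

variable {A} {c c' : ℝ → P} {v v' : ℝ → TangentBundle 𝓘(ℝ, EP) P}

theorem IsTangentAt.congr_of_eventuallyEq {t : ℝ} (h : A.IsTangentAt c v t) (hc : c' =ᶠ[𝓝 t] c)
    (hv : v' =ᶠ[𝓝 t] v) : A.IsTangentAt c' v' t := by
  have hvelocity : (mfderiv% c' t 1 : EP) = (mfderiv% c t 1 : EP) :=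
    congrArg (fun L : ℝ →L[ℝ] EP => L 1) (hc.mfderiv_eq (I := 𝓘(ℝ, ℝ)) (I' := 𝓘(ℝ, EP)))
  let Φ (p : P) (u : EP) (z : TangentBundle 𝓘(ℝ, EP) P) : EG :=
    extDerivOneForm (F := EG) A.form p u (z.snd : EP)
  have hderiv : Φ (c' t) (mfderiv% c' t 1) (v' t) = Φ (c t) (mfderiv% c t 1) (v t) :=
    congr (congr (congrArg Φ hc.self_of_nhds) hvelocity) hv.self_of_nhds
  exact {
    mdifferentiableAt := h.mdifferentiableAt.congr_of_eventuallyEq hc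
    form_eq_zero := (congrArg (fun L : ℝ →L[ℝ] EG => L 1)
      (pullbackForm_congr (F := EG) A.form hc)).trans h.form_eq_zero
    hasDerivAt := (h.hasDerivAt.congr_of_eventuallyEq
      (hv.mono fun s hs => congrArg (fun z => (A.form z.proj z.snd : EG)) hs)).congr_deriv
        hderiv.symm }

theorem IsTangentAt.comp {φ : ℝ → ℝ} {r u : ℝ} (h : A.IsTangentAt c v (φ u))
    (hφ : HasDerivAt φ r u) : A.IsTangentAt (c ∘ φ) (v ∘ φ) u := by
  have hvelocity := mfderiv_comp_apply_one h.mdifferentiableAt hφ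
  have hderiv : extDerivOneForm (F := EG) A.form (c (φ u)) (mfderiv% (c ∘ φ) u 1 : EP)
      ((v (φ u)).snd : EP) =
      r • extDerivOneForm (F := EG) A.form (c (φ u)) (mfderiv% c (φ u) 1 : EP)
        ((v (φ u)).snd : EP) :=
    (congrArg (fun w : EP => extDerivOneForm (F := EG) A.form (c (φ u)) w ((v (φ u)).snd : EP))
      hvelocity).trans (extDerivOneForm_smul_left (F := EG) A.form r _ _)
  exact {
    mdifferentiableAt := h.mdifferentiableAt.comp u hφ.differentiableAt.mdifferentiableAt
    form_eq_zero := by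
      refine (congrArg (A.form (c (φ u))) hvelocity).trans ?_
      refine (map_smul (A.form (c (φ u))) r _).trans ?_
      exact (congrArg (r • ·) h.form_eq_zero).trans (smul_zero r)
    hasDerivAt := hderiv.symm ▸ h.hasDerivAt.scomp u hφ }

theorem continuousOn_form {Y : Type*} [TopologicalSpace Y] {s : Set Y}
    {v : Y → TangentBundle 𝓘(ℝ, EP) P} (hv : ContinuousOn v s) :
    ContinuousOn (fun y => (A.form (v y).proj (v y).snd : EG)) s :=
  A.contMDiff_form.continuous.comp_continuousOn hv

end IsTangentAt

section UniquenessOfTangentFields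

variable [IsManifold 𝓘(ℝ, EP) ∞ P] [LieGroup 𝓘(ℝ, EG) ∞ G] {B : PrincipalBundle EG EP EM G P M}

theorem eq_of_form_eq_of_tangentMap_proj_eq (A : ConnectionForm B)
    {z z' : TangentBundle 𝓘(ℝ, EP) P} (h : z.proj = z'.proj)
    (hform : (A.form z.proj z.snd : EG) = A.form z'.proj z'.snd)
    (hproj : tangentMap 𝓘(ℝ, EP) 𝓘(ℝ, EM) B.proj z = tangentMap 𝓘(ℝ, EP) 𝓘(ℝ, EM) B.proj z') :
    z = z' := by
  obtain ⟨p, w⟩ := z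
  obtain ⟨_, w'⟩ := z'
  obtain rfl := h
  exact congrArg (Bundle.TotalSpace.mk p)
    (A.eq_of_form_eq_of_mfderiv_proj_eq hform (eq_of_heq (Bundle.TotalSpace.mk.inj hproj).2))

theorem extDerivOneForm_eq_of_tangentMap_proj_eq (A : ConnectionForm B) {p : P}
    {u : TangentSpace 𝓘(ℝ, EP) p} (hu : A.form p u = 0) {z z' : TangentBundle 𝓘(ℝ, EP) P}
    (hz : z.proj = p) (hz' : z'.proj = p)
    (hproj : tangentMap 𝓘(ℝ, EP) 𝓘(ℝ, EM) B.proj z = tangentMap 𝓘(ℝ, EP) 𝓘(ℝ, EM) B.proj z') :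
    extDerivOneForm (F := EG) A.form p u (z.snd : EP) =
      extDerivOneForm (F := EG) A.form p u (z'.snd : EP) := by
  obtain ⟨p, w⟩ := z
  obtain ⟨_, w'⟩ := z'
  obtain rfl := hz
  obtain rfl := hz'
  have hvert : mfderiv% B.proj _ (w - w') = 0 := by
    rw [map_sub, sub_eq_zero]
    exact eq_of_heq (Bundle.TotalSpace.mk.inj hproj).2
  exact sub_eq_zero.1 ((extDerivOneForm_sub_right (F := EG) A.form u w w').symm.trans
    (A.extDerivOneForm_eq_zero_of_mfderiv_proj_eq_zero hu hvert))

variable {A : ConnectionForm B}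

theorem eqOn_of_isTangentAt {c₁ c₂ : ℝ → P} {v₁ v₂ : ℝ → TangentBundle 𝓘(ℝ, EP) P} {a b : ℝ}
    {s : Set ℝ} (hs : s.Countable)
    (hc₁ : ContinuousOn c₁ (Icc a b)) (hc₂ : ContinuousOn c₂ (Icc a b))
    (hv₁ : IsContinuousFieldAlong c₁ v₁ a b) (hv₂ : IsContinuousFieldAlong c₂ v₂ a b)
    (htan₁ : ∀ u ∈ Ioo a b \ s, A.IsTangentAt c₁ v₁ u)
    (htan₂ : ∀ u ∈ Ioo a b \ s, A.IsTangentAt c₂ v₂ u)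
    (hproj : ∀ u ∈ Icc a b, tangentMap 𝓘(ℝ, EP) 𝓘(ℝ, EM) B.proj (v₁ u) =
      tangentMap 𝓘(ℝ, EP) 𝓘(ℝ, EM) B.proj (v₂ u)) (ha : v₁ a = v₂ a) :
    EqOn v₁ v₂ (Icc a b) := by
  intro u hu
  have ha_mem : a ∈ Icc a b := left_mem_Icc.2 (hu.1.trans hu.2)
  have hc : EqOn c₁ c₂ (Icc a b) := A.eqOn_of_form_mfderiv_eq_zero hs hc₁ hc₂
    (fun t ht => (htan₁ t ht).mdifferentiableAt) (fun t ht => (htan₂ t ht).mdifferentiableAt)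
    (fun t ht => (htan₁ t ht).form_eq_zero) (fun t ht => (htan₂ t ht).form_eq_zero)
    (fun t ht => by
      rw [← hv₁.2 t ht, ← hv₂.2 t ht]
      exact congrArg Bundle.TotalSpace.proj (hproj t ht))
    (by rw [← hv₁.2 a ha_mem, ← hv₂.2 a ha_mem, ha])
  let f (v : ℝ → TangentBundle 𝓘(ℝ, EP) P) (t : ℝ) : EG := A.form (v t).proj (v t).snd
  have hderiv (t : ℝ) (ht : t ∈ Ioo a b \ s) : HasDerivAt (fun t => f v₁ t - f v₂ t) 0 t := by
    have ht_mem := Ioo_subset_Icc_self ht.1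
    have htan₂' := (htan₂ t ht).congr_of_eventuallyEq
      (Filter.eventually_of_mem (Icc_mem_nhds ht.1.1 ht.1.2) hc) .rfl
    have heq := A.extDerivOneForm_eq_of_tangentMap_proj_eq (htan₁ t ht).form_eq_zero
      (hv₁.2 t ht_mem) ((hv₂.2 t ht_mem).trans (hc ht_mem).symm) (hproj t ht_mem)
    exact sub_eq_zero.2 heq ▸ (htan₁ t ht).hasDerivAt.sub htan₂'.hasDerivAt
  have hf_cont {v : ℝ → TangentBundle 𝓘(ℝ, EP) P} (hv : ContinuousOn v (Icc a b)) :
      ContinuousOn (f v) (uIcc a u) :=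
    (continuousOn_form hv).mono (uIcc_of_le hu.1 ▸ Icc_subset_Icc_right hu.2)
  have hconst : f v₁ u - f v₂ u = f v₁ a - f v₂ a :=
    eq_of_hasDerivAt_zero_off_countable hs ((hf_cont hv₁.1).sub (hf_cont hv₂.1)) fun t ht =>
      hderiv t ⟨⟨(le_min le_rfl hu.1).trans_lt ht.1.1,
        ht.1.2.trans_le (max_le ha_mem.2 hu.2)⟩, ht.2⟩
  have hform_a : f v₁ a = f v₂ a :=
    congrArg (fun z : TangentBundle 𝓘(ℝ, EP) P => (A.form z.proj z.snd : EG)) ha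
  have hform : f v₁ u = f v₂ u := sub_eq_zero.1 (hconst.trans (sub_eq_zero.2 hform_a))
  exact A.eq_of_form_eq_of_tangentMap_proj_eq
    ((hv₁.2 u hu).trans ((hc hu).trans (hv₂.2 u hu).symm)) hform (hproj u hu)

end UniquenessOfTangentFields

section TangencyCondition

variable [IsManifold 𝓘(ℝ, EP) ∞ P] {B : PrincipalBundle EG EP EM G P M} {A : ConnectionForm B}
  {c : ℝ → P} {v : ℝ → TangentBundle 𝓘(ℝ, EP) P} {a b : ℝ}

theorem IsHorizontal.isTangentAt {t : ℝ} (hor : A.IsHorizontal c a b)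
    (htan : A.TangencyCondition c v a b) (hv : (v t).proj = c t) (ht : t ∈ Ioo a b)
    (hc : MDiffAt c t) : A.IsTangentAt c v t := by
  have ht_mem := Ioo_subset_Icc_self ht
  have hvel : HasVelocityAt (E := EP) c a b t := hc.mdifferentiableWithinAt
  have hzero := hor t ht_mem hvel
  have hv_eq : v t = ⟨c t, ((v t).snd : EP)⟩ :=
    congrArg (fun p : P => (⟨p, ((v t).snd : EP)⟩ : TangentBundle 𝓘(ℝ, EP) P)) hv
  have hderiv := HasDerivWithinAt.hasDerivAt (F := EG) (htan t ht_mem hvel _ hv_eq)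
    (Icc_mem_nhds ht.1 ht.2)
  have hvelocity := velocity_eq_mfderiv (E := EP) (c := c) ht
  exact {
    mdifferentiableAt := hc
    form_eq_zero := (congrArg (A.form (c t)) hvelocity).symm.trans hzero
    hasDerivAt := hderiv.congr_deriv ((A.curvature_eq_extDerivOneForm hzero _).trans
      (congrArg (fun w : EP => extDerivOneForm (F := EG) A.form (c t) w ((v t).snd : EP))
        hvelocity)) }

theorem IsHorizontal.isTangentAt_off_finite (hor : A.IsHorizontal c a b)
    (htan : A.TangencyCondition c v a b) (hc : IsPiecewiseC1 (E := EP) c a b)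
    (hv : IsContinuousFieldAlong c v a b) :
    ∃ s : Set ℝ, s.Finite ∧ ∀ t ∈ Ioo a b \ s, A.IsTangentAt c v t := by
  obtain ⟨s, hs, hdiff⟩ := hc.mdifferentiableAt_off_finite
  exact ⟨s, hs, fun t ht =>
    hor.isTangentAt htan (hv.2 t (Ioo_subset_Icc_self ht.1)) ht.1 (hdiff t ht)⟩

theorem form_velocity_eq_zero (hab : a < b)
    (hc : ContMDiffOn 𝓘(ℝ, ℝ) 𝓘(ℝ, EP) 1 c (Icc a b))
    (hor : ∀ t ∈ Ioo a b, A.form (c t) (mfderiv% c t 1) = 0) {t : ℝ} (ht : t ∈ Icc a b) :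
    A.form (c t) (velocity c a b t) = 0 := by
  let f (u : ℝ) : EG := A.form (c u) (velocity c a b u)
  have hf : ContinuousOn f (Icc a b) := continuousOn_form (continuousOn_velocity hab hc)
  have hf_zero : EqOn f 0 (Ioo a b) := fun u hu =>
    (congrArg (A.form (c u)) (velocity_eq_mfderiv hu)).trans (hor u hu)
  exact hf_zero.of_subset_closure hf continuousOn_const Ioo_subset_Icc_self
    (closure_Ioo hab.ne).ge ht

theorem hasDerivWithinAt_form (hab : a < b) (hc : ContMDiffOn 𝓘(ℝ, ℝ) 𝓘(ℝ, EP) 1 c (Icc a b))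
    (hv : IsContinuousFieldAlong c v a b) (htan : ∀ t ∈ Ioo a b, A.IsTangentAt c v t) {t : ℝ}
    (ht : t ∈ Icc a b) :
    HasDerivWithinAt (F := EG) (fun s => A.form (v s).proj (v s).snd)
      (extDerivOneForm (F := EG) A.form (c t) (velocity (E := EP) c a b t) ((v t).snd : EP))
      (Icc a b) t := by
  let D (u : ℝ) : EG :=
    extDerivOneForm (F := EG) A.form (c u) (velocity (E := EP) c a b u) ((v u).snd : EP)
  have hv' : ContinuousOn (fun u => (⟨c u, ((v u).snd : EP)⟩ : TangentBundle 𝓘(ℝ, EP) P))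
      (Icc a b) := hv.1.congr fun u hu =>
    congrArg (fun p : P => (⟨p, ((v u).snd : EP)⟩ : TangentBundle 𝓘(ℝ, EP) P)) (hv.2 u hu).symm
  have hD : ContinuousOn D (Icc a b) := fun u hu =>
    A.isSmoothOneForm.continuousWithinAt_extDerivOneForm (continuousOn_velocity hab hc u hu)
      (hv' u hu)
  refine hasDerivWithinAt_Icc_of_continuousOn (D := D) hab (continuousOn_form hv.1) hD
    (fun u hu => ?_) ht
  exact (htan u hu).hasDerivAt.congr_deriv (congrArg (fun w : EP =>
    extDerivOneForm (F := EG) A.form (c u) w ((v u).snd : EP)) (velocity_eq_mfderiv hu).symm)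

theorem isHorizontal_of_form_mfderiv_eq_zero (hab : a < b) (hc : IsPiecewiseC1 (E := EP) c a b)
    {s : Set ℝ} (hs : s.Finite)
    (hor : ∀ t ∈ Ioo a b \ s, A.form (c t) (mfderiv% c t 1) = 0) : A.IsHorizontal c a b := by
  intro t ht hvel
  obtain ⟨-, s', hC1⟩ := hc
  obtain ⟨x, y, hxy, htxy, hsub, -, hleft, hright⟩ :=
    exists_Icc_mem_nhdsWithin_disjoint (hs.union s'.finite_toSet) hab ht
  have piece {x' y' : ℝ} (hxy' : x' < y') (hsub' : Icc x' y' ⊆ Icc a b) (ht' : t ∈ Icc x' y')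
      (hdisj : Disjoint (Ioo x' y') (s ∪ s')) : A.form (c t) (velocity c a b t) = 0 := by
    rw [disjoint_union_right] at hdisj
    have hzero := A.form_velocity_eq_zero hxy' (hC1 x' y' hxy' hsub' hdisj.2) (fun u hu =>
      hor u ⟨Ioo_subset_Ioo (hsub' (left_mem_Icc.2 hxy'.le)).1
        (hsub' (right_mem_Icc.2 hxy'.le)).2 hu, disjoint_left.1 hdisj.1 hu⟩) ht'
    rwa [velocity_eq_of_Icc_subset hxy' hsub' ht' hvel] at hzero
  rcases htxy.1.lt_or_eq with hxt | rfl
  · exact piece hxt ((Icc_subset_Icc_right htxy.2).trans hsub) (right_mem_Icc.2 hxt.le) hleft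
  · exact piece hxy hsub htxy hright

theorem tangencyCondition_of_isTangentAt (hab : a < b) (hc : IsPiecewiseC1 (E := EP) c a b)
    (hv : IsContinuousFieldAlong c v a b) {s : Set ℝ} (hs : s.Finite)
    (htan : ∀ t ∈ Ioo a b \ s, A.IsTangentAt c v t) : A.TangencyCondition c v a b := by
  intro t ht hvel w hw
  have hzero := A.isHorizontal_of_form_mfderiv_eq_zero hab hc hs
    (fun u hu => (htan u hu).form_eq_zero) t ht hvel
  obtain ⟨-, s', hC1⟩ := hc
  obtain ⟨x, y, -, htxy, hsub, hnhds, hleft, hright⟩ :=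
    exists_Icc_mem_nhdsWithin_disjoint (hs.union s'.finite_toSet) hab ht
  have piece {x' y' : ℝ} (hxy' : x' ≤ y') (hsub' : Icc x' y' ⊆ Icc a b) (ht' : t ∈ Icc x' y')
      (hdisj : Disjoint (Ioo x' y') (s ∪ s')) :
      HasDerivWithinAt (F := EG) (fun s => A.form (v s).proj (v s).snd)
        (extDerivOneForm (F := EG) A.form (c t) (velocity c a b t) ((v t).snd : EP))
        (Icc x' y') t := by
    rcases hxy'.eq_or_lt with rfl | hlt
    · exact HasFDerivWithinAt.of_subsingleton (subsingleton_Icc_of_ge le_rfl)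
    rw [disjoint_union_right] at hdisj
    have hderiv := A.hasDerivWithinAt_form hlt (hC1 x' y' hlt hsub' hdisj.2)
      ⟨hv.1.mono hsub', fun u hu => hv.2 u (hsub' hu)⟩ (fun u hu =>
      htan u ⟨Ioo_subset_Ioo (hsub' (left_mem_Icc.2 hxy')).1
        (hsub' (right_mem_Icc.2 hxy')).2 hu, disjoint_left.1 hdisj.1 hu⟩) ht'
    rwa [velocity_eq_of_Icc_subset hlt hsub' ht' hvel] at hderiv
  have hunion := (piece htxy.1 ((Icc_subset_Icc_right htxy.2).trans hsub)
    (right_mem_Icc.2 htxy.1) hleft).union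
    (piece htxy.2 ((Icc_subset_Icc_left htxy.1).trans hsub) (left_mem_Icc.2 htxy.2) hright)
  rw [Icc_union_Icc_eq_Icc htxy.1 htxy.2] at hunion
  have hw_eq : ((v t).snd : EP) = w :=
    congrArg (fun z : TangentBundle 𝓘(ℝ, EP) P => (z.snd : EP)) hw
  rw [A.curvature_eq_extDerivOneForm hzero]
  exact hw_eq ▸ hunion.mono_of_mem_nhdsWithin hnhds

end TangencyCondition

section Backtracking

variable {B : PrincipalBundle EG EP EM G P M} {c : ℝ → P} {v : ℝ → TangentBundle 𝓘(ℝ, EP) P}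
  {t₀ t₁ T δ : ℝ}

theorem IsTangentAt.eraseBacktrack [IsManifold 𝓘(ℝ, EP) 1 P] {A : ConnectionForm B} {t : ℝ}
    (ht : t ≠ T) (hlt : t < T → A.IsTangentAt c v t) (hgt : T < t → A.IsTangentAt c v (t + 2 * δ)) :
    A.IsTangentAt (eraseBacktrack c T δ) (eraseBacktrack v T δ) t := by
  rcases lt_or_gt_of_ne ht with htT | hTt
  · have hev : ∀ᶠ z in 𝓝 t, z ≤ T := eventually_le_nhds htT
    exact (hlt htT).congr_of_eventuallyEq (hev.mono fun z hz => if_pos hz)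
      (hev.mono fun z hz => if_pos hz)
  · have hev : ∀ᶠ z in 𝓝 t, T < z := eventually_gt_nhds hTt
    have hshift : A.IsTangentAt (c ∘ (· + 2 * δ)) (v ∘ (· + 2 * δ)) t :=
      (hgt hTt).comp (φ := (· + 2 * δ)) ((hasDerivAt_id t).add_const (2 * δ))
    exact hshift.congr_of_eventuallyEq (hev.mono fun z hz => if_neg hz.not_ge)
      (hev.mono fun z hz => if_neg hz.not_ge)

theorem isTangentAt_eraseBacktrack_off_finite [IsManifold 𝓘(ℝ, EP) 1 P] {A : ConnectionForm B}
    {s : Set ℝ} (hs : s.Finite) (hδ : 0 ≤ δ) (htan : ∀ t ∈ Ioo t₀ t₁ \ s, A.IsTangentAt c v t) :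
    ∃ s' : Set ℝ, s'.Finite ∧ ∀ t ∈ Ioo t₀ (t₁ - 2 * δ) \ s',
      A.IsTangentAt (eraseBacktrack c T δ) (eraseBacktrack v T δ) t := by
  refine ⟨insert T (s ∪ (· + 2 * δ) ⁻¹' s),
    (hs.union (hs.preimage (add_left_injective _).injOn)).insert T, fun t ⟨ht, hts⟩ => ?_⟩
  simp only [mem_insert_iff, mem_union, mem_preimage, not_or] at hts
  exact .eraseBacktrack hts.1
    (fun _ => htan t ⟨⟨ht.1, by linarith [ht.2]⟩, hts.2.1⟩)
    (fun _ => htan _ ⟨⟨by linarith [ht.1], by linarith [ht.2]⟩, hts.2.2⟩)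

theorem backtracksOver_of_tangentMap_proj [IsManifold 𝓘(ℝ, EP) ∞ P] [LieGroup 𝓘(ℝ, EG) ∞ G]
    {A : ConnectionForm B} {s : Set ℝ} (hs : s.Countable) (hc : ContinuousOn c (Icc t₀ t₁))
    (hv : IsContinuousFieldAlong c v t₀ t₁) (htan : ∀ t ∈ Ioo t₀ t₁ \ s, A.IsTangentAt c v t)
    (hback : BacktracksOver (tangentMap 𝓘(ℝ, EP) 𝓘(ℝ, EM) B.proj ∘ v) t₀ t₁ T δ) :
    BacktracksOver v t₀ t₁ T δ := by
  obtain ⟨hT, hδ, hT', hproj⟩ := backtracksOver_iff_eqOn_reflection.1 hback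
  let forth (u : ℝ) : ℝ := T + δ + u
  let back (u : ℝ) : ℝ := T + δ - u
  have hforth_cont : ContinuousOn forth (Icc 0 δ) := by fun_prop
  have hback_cont : ContinuousOn back (Icc 0 δ) := by fun_prop
  have hforth_maps : MapsTo forth (Icc 0 δ) (Icc t₀ t₁) := fun u hu =>
    ⟨by linarith [hu.1], by linarith [hu.2]⟩
  have hback_maps : MapsTo back (Icc 0 δ) (Icc t₀ t₁) := fun u hu =>
    ⟨by linarith [hu.2], by linarith [hu.1]⟩
  have hs' : (forth ⁻¹' s ∪ back ⁻¹' s).Countable :=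
    (hs.preimage (add_right_injective _)).union (hs.preimage sub_right_injective)
  have hforth_tan (u : ℝ) (hu : u ∈ Ioo 0 δ \ (forth ⁻¹' s ∪ back ⁻¹' s)) :
      A.IsTangentAt (c ∘ forth) (v ∘ forth) u :=
    (htan (forth u) ⟨⟨by linarith [hu.1.1], by linarith [hu.1.2]⟩, fun h => hu.2 (.inl h)⟩).comp
      ((hasDerivAt_id u).const_add (T + δ))
  have hback_tan (u : ℝ) (hu : u ∈ Ioo 0 δ \ (forth ⁻¹' s ∪ back ⁻¹' s)) :
      A.IsTangentAt (c ∘ back) (v ∘ back) u :=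
    (htan (back u) ⟨⟨by linarith [hu.1.2], by linarith [hu.1.1]⟩, fun h => hu.2 (.inr h)⟩).comp
      ((hasDerivAt_id u).const_sub (T + δ))
  have hmid : v (forth 0) = v (back 0) := congrArg v ((add_zero _).trans (sub_zero _).symm)
  exact backtracksOver_iff_eqOn_reflection.2 ⟨hT, hδ, hT', eqOn_of_isTangentAt hs'
    (hc.comp hforth_cont hforth_maps) (hc.comp hback_cont hback_maps)
    (hv.comp hforth_cont hforth_maps) (hv.comp hback_cont hback_maps) hforth_tan hback_tan
    hproj hmid⟩

end Backtracking

end ConnectionForm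

end Connections

theorem propositionP_general
    {EG : Type*} [NormedAddCommGroup EG] [NormedSpace ℝ EG]
    {EP : Type*} [NormedAddCommGroup EP] [NormedSpace ℝ EP]
    {EM : Type*} [NormedAddCommGroup EM] [NormedSpace ℝ EM]
    {G : Type*} [TopologicalSpace G] [ChartedSpace EG G] [Group G] [LieGroup 𝓘(ℝ, EG) ∞ G]
    {P : Type*} [TopologicalSpace P] [ChartedSpace EP P] [IsManifold 𝓘(ℝ, EP) ∞ P]
    {M : Type*} [TopologicalSpace M] [ChartedSpace EM M]
    {B : PrincipalBundle EG EP EM G P M} {A : ConnectionForm B} {t₀ t₁ T δ : ℝ}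
    {c : ℝ → P} (hc : IsPiecewiseC1 (E := EP) c t₀ t₁) (hc_hor : A.IsHorizontal c t₀ t₁)
    {v : ℝ → TangentBundle 𝓘(ℝ, EP) P} (hv : IsContinuousFieldAlong c v t₀ t₁)
    (hv_tan : A.TangencyCondition c v t₀ t₁)
    (hv_back : BacktracksOver (tangentMap 𝓘(ℝ, EP) 𝓘(ℝ, EM) B.proj ∘ v) t₀ t₁ T δ) :
    BacktracksOver c t₀ t₁ T δ ∧
    BacktracksOver v t₀ t₁ T δ ∧
    (IsPiecewiseC1 (E := EP) (eraseBacktrack c T δ) t₀ (t₁ - 2 * δ) ∧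
      A.IsHorizontal (eraseBacktrack c T δ) t₀ (t₁ - 2 * δ) ∧
      IsContinuousFieldAlong (eraseBacktrack c T δ) (eraseBacktrack v T δ) t₀ (t₁ - 2 * δ) ∧
      A.TangencyCondition (eraseBacktrack c T δ) (eraseBacktrack v T δ) t₀ (t₁ - 2 * δ)) := by
  have ⟨hT, hδ, hT', _⟩ := hv_back
  obtain ⟨s, hs, htan⟩ := hc_hor.isTangentAt_off_finite hv_tan hc hv
  have hv_lift : BacktracksOver v t₀ t₁ T δ :=
    ConnectionForm.backtracksOver_of_tangentMap_proj hs.countable hc.1 hv htan hv_back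
  have hc_lift : BacktracksOver c t₀ t₁ T δ :=
    hv_lift.of_comp_eqOn (f := Bundle.TotalSpace.proj) hv.2
  have hc_erase := hc_lift.isPiecewiseC1_eraseBacktrack hc
  have hv_erase := hv.eraseBacktrack hv_lift
  obtain ⟨s', hs', htan_erase⟩ := ConnectionForm.isTangentAt_eraseBacktrack_off_finite (T := T) hs
    (by linarith : 0 ≤ δ) htan
  have hlt : t₀ < t₁ - 2 * δ := by linarith
  exact ⟨hc_lift, hv_lift, hc_erase,
    ConnectionForm.isHorizontal_of_form_mfderiv_eq_zero hlt hc_erase hs'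
      fun t ht => (htan_erase t ht).form_eq_zero,
    hv_erase,
    ConnectionForm.tangencyCondition_of_isTangentAt hlt hc_erase hv_erase hs' htan_erase⟩

theorem propositionP
    {EG : Type*} [NormedAddCommGroup EG] [NormedSpace ℝ EG] [FiniteDimensional ℝ EG]
    {EP : Type*} [NormedAddCommGroup EP] [NormedSpace ℝ EP] [FiniteDimensional ℝ EP]
    {EM : Type*} [NormedAddCommGroup EM] [NormedSpace ℝ EM] [FiniteDimensional ℝ EM]
    {G : Type*} [TopologicalSpace G] [T2Space G] [ChartedSpace EG G] [Group G]
    [LieGroup 𝓘(ℝ, EG) ∞ G]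
    {P : Type*} [TopologicalSpace P] [T2Space P] [ChartedSpace EP P] [IsManifold 𝓘(ℝ, EP) ∞ P]
    {M : Type*} [TopologicalSpace M] [T2Space M] [ChartedSpace EM M] [IsManifold 𝓘(ℝ, EM) ∞ M]
    (B : PrincipalBundle EG EP EM G P M) (A : ConnectionForm B)
    (t₀ t₁ T δ : ℝ)
    (c : ℝ → P) (hc : IsPiecewiseC1 (E := EP) c t₀ t₁) (hc_hor : A.IsHorizontal c t₀ t₁)
    (v : ℝ → TangentBundle 𝓘(ℝ, EP) P) (hv : IsContinuousFieldAlong c v t₀ t₁)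
    (hv_tan : A.TangencyCondition c v t₀ t₁)
    (hc_back : BacktracksOver (B.proj ∘ c) t₀ t₁ T δ)
    (hv_back : BacktracksOver (tangentMap 𝓘(ℝ, EP) 𝓘(ℝ, EM) B.proj ∘ v) t₀ t₁ T δ) :
    BacktracksOver c t₀ t₁ T δ ∧
    BacktracksOver v t₀ t₁ T δ ∧
    (IsPiecewiseC1 (E := EP) (eraseBacktrack c T δ) t₀ (t₁ - 2 * δ) ∧
      A.IsHorizontal (eraseBacktrack c T δ) t₀ (t₁ - 2 * δ) ∧
      IsContinuousFieldAlong (eraseBacktrack c T δ) (eraseBacktrack v T δ) t₀ (t₁ - 2 * δ) ∧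
      A.TangencyCondition (eraseBacktrack c T δ) (eraseBacktrack v T δ) t₀ (t₁ - 2 * δ)) :=
  propositionP_general hc hc_hor hv hv_tan hv_back
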